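/- Let $k,m\ge 1$ and let $\lambda,\mu:\mathbb R\to[0,\infty)$ be continuous (for instance periodic). Consider the $E_k/E_m/1$ queue with arrival-phase rate $\lambda(t)$ and service-phase rate $\mu(t)$. Its states are $(0,a)$ (empty system, arrival phase $a$) and $(n,a,s)$ ($n\ge1$ customers, arrival phase $a\in\{1,\dots,k\}$, service phase $s\in\{1,\dots,m\}$). Let $D_0(t)$ be the $k\times k$ matrix with $-\lambda(t)$ on the diagonal and $\lambda(t)$ just above it, and $D_1(t)$ the $k\times k$ matrix whose only nonzero entry is $\lambda(t)$ in the lower left corner; let $C_0(t),C_1(t)$ be the analogous $m\times m$ matrices for $\mu(t)$. Put $$A_{-1}(t)=I_k\otimes C_1(t),\qquad A_0(t)=D_0(t)\otimes I_m+I_k\otimes C_0(t),\qquad A_1(t)=D_1(t)\otimes I_m .$$ The state is a right-continuous continuous-time Markov chain $(X_t)_{t\ge u}$ whose generator has the blocks $A_1(t),A_0(t),A_{-1}(t)$ between levels $n\ge1$ (up one level, same level, down one level), the block $D_0(t)$ at level $0$, and the boundary transitions $(0,k)\to(1,1,1)$ at rate $\lambda(t)$ and $(1,a,m)\to(0,a)$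 at rate $\mu(t)$. Being a Markov chain with this generator means that for every state $y$ the process $1_{\{X_t=y\}}-\int_u^t Q(r)_{X_r,y}\,dr$ is a martingale in the filtration generated by $X$. Let $N(t)$ be the number of customers. Let $j\ge1$, let $q=(a_0,s_0)$ be a pair of phases, and suppose that the event $\{N(u)=j,\ \text{phases }q\text{ at time }u\}$ has positive probability. Let $\tau_j=\inf\{t>u: N(t)=0\}$. Let $Q_0^{(j)}(t)$ be the row vector of length $km$ whose $(a,s)$ entry is the conditional probability, given this event, that $\tau_j<t$ and the phase pair at time $\tau_j$ is $(a,s)$; here the service completion that empties the system resets the service phase to $1$, so that the state $(0,a)$ carries the phase pair $(a,1)$ and the entries with $s\ne1$ vanish. Then the entries of $Q_0^{(j)}(t)$ add up to the conditional probability of $\{\tau_j<t\}$ for every $t\ge u$. For $z\in\mathbb C\setminus\{0\}$ let $A_z(t)=zA_1(t)+A_0(t)+z^{-1}A_{-1}(t)$. There is an evolution operator $\Phi(z,\nu,t)$, $\nu,t\in\mathbb R$, that is, a solution of $$\partial_t\Phi(z,\nu,t)=\Phi(z,\nu,t)A_z(t),\qquad \partial_\nu\Phi(z,\nu,t)=-A_z(\nu)\Phi(z,\nu,t),\qquad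 \Phi(z,t,t)=I .$$ Every such $\Phi$ is the sum of its Laurent series in $z$ on $\mathbb C\setminus\{0\}$; let $[z^n]\Phi(z,\nu,t)$ be its matrix coefficients. Then $Q_0^{(j)}$ satisfies the Volterra integral equation of the second kind: for every $t\ge u$ the integrand below is integrable on $[u,t]$ and $$Q_0^{(j)}(t)=e_q\,[z^{-j}]\Phi(z,u,t)-\int_u^t Q_0^{(j)}(\nu)\Bigl(A_{-1}(\nu)[z^{1}]\Phi(z,\nu,t)+A_0(\nu)[z^{0}]\Phi(z,\nu,t)+A_1(\nu)[z^{-1}]\Phi(z,\nu,t)\Bigr)\,d\nu ,$$ where $e_q$ is the row vector with a one in component $q$ and zeros elsewhere. -/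

import Mathlib

open MeasureTheory Filter Topology
open scoped Kronecker

namespace ErlangQueue

/-- A pair (arrival phase, service phase); the first phases are `(0, 0)`. -/
abbrev Phase (k m : ℕ) := Fin k × Fin m

/-- States of the queue: `Sum.inl a` is the empty system with arrival phase `a`;
`Sum.inr (n, a, s)` is the system with `n ≥ 1` customers, arrival phase `a`, service phase `s`. -/
abbrev State (k m : ℕ) := Fin k ⊕ (ℕ+ × Phase k m)

/-- Transitions between consecutive phases at rate `r`, without completion of the last phase:
`-r` on the diagonal and `r` just above it.  (This is `D₀` for `r = λ(t)`, `C₀` for `r = μ(t)`.) -/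
def phaseMatrix (k : ℕ) (r : ℝ) : Matrix (Fin k) (Fin k) ℝ :=
  Matrix.of fun a b => if a = b then -r else if a.val + 1 = b.val then r else 0

/-- Completion of the last phase at rate `r`: the only entry is `r`, in the lower left corner.
(This is `D₁` for `r = λ(t)`, `C₁` for `r = μ(t)`.) -/
def completionMatrix (k : ℕ) (r : ℝ) : Matrix (Fin k) (Fin k) ℝ :=
  Matrix.of fun a b => if a.val + 1 = k ∧ b.val = 0 then r else 0

section Rates

variable {k m : ℕ} (lam mu : ℝ → ℝ)

/-- `A₋₁(t) = I ⊗ C₁(t)`. -/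
def Aneg (t : ℝ) : Matrix (Phase k m) (Phase k m) ℝ :=
  (1 : Matrix (Fin k) (Fin k) ℝ) ⊗ₖ completionMatrix m (mu t)

/-- `A₀(t) = D₀(t) ⊗ I + I ⊗ C₀(t)`. -/
def Azero (t : ℝ) : Matrix (Phase k m) (Phase k m) ℝ :=
  phaseMatrix k (lam t) ⊗ₖ (1 : Matrix (Fin m) (Fin m) ℝ) +
    (1 : Matrix (Fin k) (Fin k) ℝ) ⊗ₖ phaseMatrix m (mu t)

/-- `A₁(t) = D₁(t) ⊗ I`. -/
def Apos (t : ℝ) : Matrix (Phase k m) (Phase k m) ℝ :=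
  completionMatrix k (lam t) ⊗ₖ (1 : Matrix (Fin m) (Fin m) ℝ)

/-- The boundary block from the empty system to one customer. -/
def Qzeroone (t : ℝ) : Matrix (Fin k) (Phase k m) ℝ :=
  Matrix.of fun a p => if a.val + 1 = k ∧ p.1.val = 0 ∧ p.2.val = 0 then lam t else 0

/-- The boundary block from one customer to the empty system: `I ⊗ (0, …, 0, μ(t))ᵀ`. -/
def Qonezero (t : ℝ) : Matrix (Phase k m) (Fin k) ℝ :=
  Matrix.of fun p a => if p.1 = a ∧ p.2.val + 1 = m then mu t else 0

/-- The infinitesimal generator `Q(t)` of the `E_k/E_m/1` queue, entry by entry. -/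
def generator (t : ℝ) : State k m → State k m → ℝ
  | Sum.inl a, Sum.inl b => phaseMatrix k (lam t) a b
  | Sum.inl a, Sum.inr (n, p) => if n = 1 then Qzeroone lam t a p else 0
  | Sum.inr (n, p), Sum.inl b => if n = 1 then Qonezero mu t p b else 0
  | Sum.inr (n, p), Sum.inr (n', p') =>
      if n' = n + 1 then Apos lam t p p'
      else if n' = n then Azero lam mu t p p'
      else if n = n' + 1 then Aneg mu t p p'
      else 0

/-- `A_z(t) = z A₁(t) + A₀(t) + z⁻¹ A₋₁(t)`. -/
noncomputable def Az (z : ℂ) (t : ℝ) : Matrix (Phase k m) (Phase k m) ℂ :=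
  z • (Apos lam t).map Complex.ofReal + (Azero lam mu t).map Complex.ofReal +
    z⁻¹ • (Aneg mu t).map Complex.ofReal

end Rates

section Chain

variable {Ω S : Type*}

/-- The σ-algebra generated by `X r`, `u ≤ r ≤ s`. -/
abbrev past (X : ℝ → Ω → S) (u s : ℝ) : MeasurableSpace Ω :=
  ⨆ r ∈ Set.Icc u s, MeasurableSpace.comap (X r) ⊤

open Classical in
/-- The process `1{X_t = y} - ∫_u^t G(r)_{X_r, y} dr`. -/
noncomputable def compensated (G : ℝ → S → S → ℝ) (X : ℝ → Ω → S) (u : ℝ) (y : S)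
    (t : ℝ) (ω : Ω) : ℝ :=
  (if X t ω = y then 1 else 0) - ∫ r in u..t, G r (X r ω) y

/-- `(X_t)_{t ≥ u}` is a (time-inhomogeneous) continuous-time Markov chain on the discrete state
space `S` with infinitesimal generator `G(t)`: it has right-continuous (piecewise constant) paths
and solves the martingale problem of `G`, that is, for every state `y` the process
`1{X_t = y} - ∫_u^t G(r)_{X_r, y} dr` is a martingale in the filtration generated by `X`.
Equivalently, given the past up to any time, the conditional law of the future states
satisfies Kolmogorov's forward equation of `G`. -/
structure IsMarkovChain [MeasurableSpace Ω] (P : Measure Ω) (G : ℝ → S → S → ℝ) (u : ℝ)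
    (X : ℝ → Ω → S) : Prop where
  measurable : ∀ t, u ≤ t → ∀ y, MeasurableSet {ω | X t ω = y}
  right_continuous : ∀ ω t, u ≤ t → ∀ᶠ s in 𝓝[>] t, X s ω = X t ω
  martingale : ∀ y s t, u ≤ s → s ≤ t →
    P[compensated G X u y t | past X u s] =ᵐ[P] compensated G X u y s

end Chain

section FirstPassage

variable {k m : ℕ} {Ω : Type*}

/-- First passage time to the empty system: `inf {t > u : N(t) = 0}`, equal to `⊤` if the
system is never empty after time `u`. -/
noncomputable def firstPassage (X : ℝ → Ω → State k m) (u : ℝ) (ω : Ω) : EReal :=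
  sInf {x : EReal | ∃ t : ℝ, x = (t : EReal) ∧ u < t ∧ ∃ a : Fin k, X t ω = Sum.inl a}

/-- The event that there are `j` customers and the phases are `q` at time `u`. -/
def startEvent (X : ℝ → Ω → State k m) (u : ℝ) (j : ℕ+) (q : Phase k m) : Set Ω :=
  {ω | X u ω = Sum.inr (j, q)}

/-- The row vector `Q₀^{(j)}(t)` of the first-passage distribution, resolved by the phase of the
chain at the first passage and conditional on `j` customers and phases `q` at time `u`.
The system is emptied by a service completion, which resets the service phase to the first one:
the state `Sum.inl a` carries the phase pair `(a, 0)`, and the other entries are `0`. -/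
noncomputable def passageVector [MeasurableSpace Ω] (P : Measure Ω) (X : ℝ → Ω → State k m)
    (u : ℝ) (j : ℕ+) (q : Phase k m) (t : ℝ) : Phase k m → ℝ :=
  fun i =>
    if i.2.val = 0 then
      (ProbabilityTheory.cond P (startEvent X u j q)).real
        {ω | firstPassage X u ω < (t : EReal) ∧
          X (firstPassage X u ω).toReal ω = Sum.inl i.1}
    else 0

end FirstPassage

section Evolution

/-- `Ψ(u,t)` is the evolution operator of `A(t)`: `∂ₜ Ψ(u,t) = Ψ(u,t) A(t)`,
`∂ᵤ Ψ(u,t) = -A(u) Ψ(u,t)`, `Ψ(t,t) = I` (derivatives entry by entry). -/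
structure IsEvolutionOperator {ι : Type*} [Fintype ι] [DecidableEq ι]
    (A : ℝ → Matrix ι ι ℂ) (Ψ : ℝ → ℝ → Matrix ι ι ℂ) : Prop where
  deriv_right : ∀ u t i j, HasDerivAt (fun s => Ψ u s i j) ((Ψ u t * A t) i j) t
  deriv_left : ∀ u t i j, HasDerivAt (fun s => Ψ s t i j) ((-(A u * Ψ u t)) i j) u
  diag : ∀ t, Ψ t t = 1

/-- `[zⁿ] F(z) = (2πi)⁻¹ ∮_{|z| = 1} z^{-n-1} F(z) dz`, the coefficient of `zⁿ` in the Laurent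
series of a matrix function `F` on the punctured plane. -/
noncomputable def laurentCoeff {ι : Type*} (n : ℤ) (F : ℂ → Matrix ι ι ℂ) : Matrix ι ι ℂ :=
  Matrix.of fun i j =>
    (2 * Real.pi * Complex.I : ℂ)⁻¹ * ∮ z in C(0, 1), z ^ (-n - 1) * F z i j

end Evolution

/-- The kernel
`A₋₁(ν) [z¹]Φ(z,ν,t) + A₀(ν) [z⁰]Φ(z,ν,t) + A₁(ν) [z⁻¹]Φ(z,ν,t)`. -/
noncomputable def volterraKernel {k m : ℕ} (lam mu : ℝ → ℝ)
    (Φ : ℂ → ℝ → ℝ → Matrix (Phase k m) (Phase k m) ℂ) (ν t : ℝ) :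
    Matrix (Phase k m) (Phase k m) ℂ :=
  (Aneg mu ν).map Complex.ofReal * laurentCoeff 1 (fun z => Φ z ν t) +
    (Azero lam mu ν).map Complex.ofReal * laurentCoeff 0 (fun z => Φ z ν t) +
    (Apos lam ν).map Complex.ofReal * laurentCoeff (-1) (fun z => Φ z ν t)

end ErlangQueue

/-!
The proof has a probabilistic and an analytic half, which meet in a telescoping sum.

*Probability.* Let `τ` be the first passage time and `Y_t = X_{τ ∧ t}` the stopped chain. Let
`v_n(t)` be the row vector of the probabilities, given the start, that `Y_t` is on level `n`, where
the state `(0, a)` is given the phase pair `(a, 1)`. Optional sampling of the compensated indicators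
at `τ ∧ t` (`setIntegral_compensated_stopTime`) gives the forward equations of the stopped chain
(`stopped_forward_equation`, `hasDerivAt_levelVector`): `v_n' = v_{n-1} A₁ + v_n A₀ + v_{n+1} A₋₁`,
with `v_0` omitted on the right-hand side. Only right-continuity of the paths is available, so `τ ∧
t` is approximated from the right by the points of finer and finer grids (`tendsto_gridIncrement`);
left limits are never needed. The vector `v_0(t)` describes the event `τ ≤ t`, and it equals the
first-passage vector, which describes `τ < t`, since `v_0` is continuous
(`passageVector_eq_levelVector`).

*Analysis.* Evolution operators exist by the Dyson series (`exists_isEvolutionOperator`) and are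
unique, so each choice of `Φ` is jointly continuous in `z ≠ 0` and the two times. The Duhamel
formula then yields complex differentiability in `z` (`differentiableOn_evolution`), and the Laurent
series converges because it is an absolutely convergent Fourier series on each circle
(`hasSum_laurent`). The coefficients `φ_n(ν) = [zⁿ] Φ(z, ν, t)` satisfy the backward equations `φ_n'
= -(A₋₁ φ_{n+1} + A₀ φ_n + A₁ φ_{n-1})` (`hasDerivAt_laurentCoeff`).

*Conclusion.* In the derivative of `∑_{n ≤ M} v_n(ν) φ_{-n}(ν)` all terms cancel except for
`-v_0(ν)` times the Volterra kernel, because level `0` is absorbing for `v` but not for `φ`, and a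
boundary term from the levels `M` and `M + 1` (`hasDerivAt_level_sum`). Integration over `[u, t]`
together with `φ_n(t) = δ_{n0} I` gives the Volterra equation up to the integrated boundary term,
which tends to zero as `M → ∞` because the Laurent coefficients do
(`tendsto_integral_boundaryTerm`).
-/

namespace ErlangQueue

/-! ### Linear differential equations depending on a parameter -/

section Dyson

variable {Z 𝔸 : Type*} [NormedRing 𝔸]

/-- The terms of the Dyson (Peano–Baker) series of `U' = U a(z, ·)`, `U(0) = 1`. -/
noncomputable def dysonTerm [NormedAlgebra ℝ 𝔸] (a : Z → ℝ → 𝔸) : ℕ → Z → ℝ → 𝔸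
  | 0 => fun _ _ => 1
  | n + 1 => fun z t => ∫ s in (0 : ℝ)..t, dysonTerm a n z s * a z s

variable {a : Z → ℝ → 𝔸}

lemma continuous_dysonTerm [TopologicalSpace Z] [NormedAlgebra ℝ 𝔸] (ha : Continuous a.uncurry)
    (n : ℕ) :
    Continuous (dysonTerm a n).uncurry := by
  induction n with
  | zero => exact continuous_const
  | succ n ih =>
    have h : Continuous
        (fun p : (Z × ℝ) × ℝ => dysonTerm a n p.1.1 p.2 * a p.1.1 p.2) :=
      (ih.comp (f := fun p : (Z × ℝ) × ℝ => (p.1.1, p.2)) (by fun_prop)).mul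
        (ha.comp (f := fun p : (Z × ℝ) × ℝ => (p.1.1, p.2)) (by fun_prop))
    exact intervalIntegral.continuous_parametric_intervalIntegral_of_continuous
      (f := fun (p : Z × ℝ) s => dysonTerm a n p.1 s * a p.1 s) h continuous_snd

lemma norm_dysonTerm_le [NormedAlgebra ℝ 𝔸] {z : Z} {T C : ℝ}
    (hC : ∀ s, |s| ≤ T → ‖a z s‖ ≤ C) (n : ℕ) :
    ∀ t, |t| ≤ T → ‖dysonTerm a n z t‖ ≤ ‖(1 : 𝔸)‖ * (C ^ n * |t| ^ n / n.factorial) := by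
  induction n with
  | zero => intro t _; simp [dysonTerm]
  | succ n ih =>
    intro t ht
    have hC0 : 0 ≤ C := (norm_nonneg _).trans (hC 0 (by simpa using (abs_nonneg t).trans ht))
    calc ‖dysonTerm a (n + 1) z t‖
        ≤ ∫ s in Set.uIoc 0 t, ‖dysonTerm a n z s * a z s‖ :=
          intervalIntegral.norm_integral_le_integral_norm_uIoc
      _ ≤ ∫ s in Set.uIoc 0 t,
            ‖(1 : 𝔸)‖ * (C ^ (n + 1) / n.factorial) * |s - 0| ^ n := by
          refine integral_mono_of_nonneg (ae_of_all _ fun s => norm_nonneg _) ?_ ?_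
          · exact (Continuous.integrableOn_uIoc (by fun_prop))
          · refine (ae_restrict_iff' measurableSet_uIoc).2 (ae_of_all _ fun s hs => ?_)
            have hst : |s| ≤ T := by
              have := Set.abs_sub_left_of_mem_uIcc (Set.uIoc_subset_uIcc hs)
              simp only [sub_zero] at this
              exact this.trans ht
            calc ‖dysonTerm a n z s * a z s‖ ≤ ‖dysonTerm a n z s‖ * ‖a z s‖ := norm_mul_le _ _
              _ ≤ (‖(1 : 𝔸)‖ * (C ^ n * |s| ^ n / n.factorial)) * C := by
                  gcongr
                  · exact ih s hst
                  · exact hC s hst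
              _ = _ := by simp only [sub_zero]; ring
      _ = _ := by
          rw [integral_const_mul, integral_pow_abs_sub_uIoc, Nat.factorial_succ]
          push_cast
          rw [sub_zero]
          field_simp

lemma hasDerivAt_dysonTerm_succ [TopologicalSpace Z] [NormedAlgebra ℝ 𝔸] [CompleteSpace 𝔸]
    (ha : Continuous a.uncurry) (n : ℕ) (z : Z)
    (t : ℝ) : HasDerivAt (dysonTerm a (n + 1) z) (dysonTerm a n z t * a z t) t := by
  have h : Continuous fun s => dysonTerm a n z s * a z s :=
    ((continuous_dysonTerm ha n).comp (by fun_prop : Continuous fun s : ℝ => (z, s))).mul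
      (ha.comp (by fun_prop : Continuous fun s : ℝ => (z, s)))
  exact intervalIntegral.integral_hasDerivAt_right (h.intervalIntegrable _ _)
    (h.stronglyMeasurableAtFilter _ _) h.continuousAt

/-- The coefficient is bounded on compact time intervals, uniformly for parameters near `z`. -/
lemma exists_norm_le_near [TopologicalSpace Z] [LocallyCompactSpace Z]
    (ha : Continuous a.uncurry) (z : Z) (T : ℝ) :
    ∃ K ∈ 𝓝 z, ∃ C, 0 ≤ C ∧ ∀ w ∈ K, ∀ s, |s| ≤ T → ‖a w s‖ ≤ C := by
  obtain ⟨K, hK, hz⟩ := exists_compact_mem_nhds z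
  obtain ⟨C, hC⟩ := (hK.prod (isCompact_Icc (a := -T) (b := T))).exists_bound_of_continuousOn
    ha.continuousOn
  refine ⟨K, hz, max C 0, le_max_right _ _, fun w hw s hs => ?_⟩
  exact (hC (w, s) ⟨hw, abs_le.1 hs⟩).trans (le_max_left _ _)

/-- The sum of the Dyson series solves `U' = U a(z, ·)`, `U(0) = 1`, and depends continuously on
the parameter. -/
theorem exists_fundamental_solution [TopologicalSpace Z] [LocallyCompactSpace Z]
    [NormedAlgebra ℝ 𝔸] [CompleteSpace 𝔸]
    (ha : Continuous a.uncurry) :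
    ∃ U : Z → ℝ → 𝔸, Continuous U.uncurry ∧ (∀ z, U z 0 = 1) ∧
      ∀ z t, HasDerivAt (U z) (U z t * a z t) t := by
  have hsum (C T : ℝ) : Summable fun n : ℕ => ‖(1 : 𝔸)‖ * (C ^ n * T ^ n / n.factorial) := by
    simp_rw [← mul_pow]
    exact (Real.summable_pow_div_factorial _).mul_left _
  have hbound {z : Z} {T C : ℝ} (hC0 : 0 ≤ C) (hC : ∀ s, |s| ≤ T → ‖a z s‖ ≤ C) (n : ℕ) (t : ℝ)
      (ht : |t| ≤ T) : ‖dysonTerm a n z t‖ ≤ ‖(1 : 𝔸)‖ * (C ^ n * T ^ n / n.factorial) :=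
    (norm_dysonTerm_le hC n t ht).trans (by gcongr)
  refine ⟨fun z t => ∑' n, dysonTerm a n z t, ?_, fun z => ?_, fun z t => ?_⟩
  · refine continuous_iff_continuousAt.2 fun ⟨z, t⟩ => ?_
    obtain ⟨K, hK, C, hC0, hC⟩ := exists_norm_le_near ha z (|t| + 1)
    have hnhds : K ×ˢ {s : ℝ | |s| ≤ |t| + 1} ∈ 𝓝 (z, t) := by
      refine prod_mem_nhds hK ?_
      have : {s : ℝ | |s| < |t| + 1} ∈ 𝓝 t :=
        (isOpen_lt continuous_abs continuous_const).mem_nhds (by simp)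
      exact mem_of_superset this fun s (hs : |s| < |t| + 1) => hs.le
    refine ContinuousOn.continuousAt ?_ hnhds
    exact continuousOn_tsum (fun n => (continuous_dysonTerm ha n).continuousOn)
      (hsum C (|t| + 1)) fun n x hx => hbound hC0 (hC x.1 hx.1) n x.2 hx.2
  · change ∑' n, dysonTerm a n z 0 = 1
    rw [tsum_eq_single 0]
    · rfl
    · intro n hn
      obtain ⟨n, rfl⟩ := Nat.exists_eq_succ_of_ne_zero hn
      simp [dysonTerm]
  · set T := |t| + 1
    obtain ⟨K, hK, C, hC0, hC'⟩ := exists_norm_le_near ha z T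
    have hC := hC' z (mem_of_mem_nhds hK)
    have hsm (s : ℝ) (hs : |s| ≤ T) : Summable fun n => dysonTerm a n z s :=
      .of_norm_bounded (hsum C T) fun n => hbound hC0 hC n s hs
    have hmem : t ∈ Set.Ioo (-T) T := abs_lt.1 (by simp [T])
    have key : HasDerivAt (fun s => ∑' n, dysonTerm a (n + 1) z s)
        (∑' n, dysonTerm a n z t * a z t) t := by
      refine hasDerivAt_tsum_of_isPreconnected (t := Set.Ioo (-T) T) (y₀ := t)
        ((hsum C T).mul_right C) isOpen_Ioo isPreconnected_Ioo
        (fun n y _ => hasDerivAt_dysonTerm_succ ha n z y) (fun n y hy => ?_) hmem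
        ((summable_nat_add_iff 1).2 (hsm t (by simp [T]))) hmem
      have hy' : |y| ≤ T := (abs_lt.2 hy).le
      refine (norm_mul_le _ _).trans ?_
      gcongr
      · exact hbound hC0 hC n y hy'
      · exact hC y hy'
    rw [(hsm t (by simp [T])).tsum_mul_right] at key
    refine (key.const_add 1).congr_of_eventuallyEq ?_
    filter_upwards [isOpen_Ioo.mem_nhds hmem] with s hs
    rw [(hsm s (abs_lt.2 hs).le).tsum_eq_zero_add]
    rfl

end Dyson

/-! ### Evolution operators -/

section EvolutionOperators

variable {ι Z : Type*}

lemma matrix_eq_of_hasDerivAt_zero {F : ℝ → Matrix ι ι ℂ}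
    (hF : ∀ t i j, HasDerivAt (fun s => F s i j) 0 t) (s t : ℝ) : F s = F t := by
  ext i j
  exact is_const_of_deriv_eq_zero (fun r => (hF r i j).differentiableAt)
    (fun r => (hF r i j).deriv) s t

variable [Fintype ι]

lemma hasDerivAt_matrix_mul_apply {F G : ℝ → Matrix ι ι ℂ} {F' G' : Matrix ι ι ℂ} {t : ℝ}
    (hF : ∀ i j, HasDerivAt (fun s => F s i j) (F' i j) t)
    (hG : ∀ i j, HasDerivAt (fun s => G s i j) (G' i j) t) (i j : ι) :
    HasDerivAt (fun s => (F s * G s) i j) ((F' * G t + F t * G') i j) t := by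
  simp only [Matrix.mul_apply, Matrix.add_apply, ← Finset.sum_add_distrib]
  exact HasDerivAt.fun_sum fun l _ => (hF i l).mul (hG l j)

variable [DecidableEq ι]

attribute [local instance] Matrix.linftyOpNormedRing Matrix.linftyOpNormedAlgebra in
lemma exists_matrix_fundamental_solution [TopologicalSpace Z] [LocallyCompactSpace Z]
    {A : Z → ℝ → Matrix ι ι ℂ} (hA : ∀ i j, Continuous fun p : Z × ℝ => A p.1 p.2 i j) :
    ∃ U : Z → ℝ → Matrix ι ι ℂ, (∀ i j, Continuous fun p : Z × ℝ => U p.1 p.2 i j) ∧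
      (∀ z, U z 0 = 1) ∧
      ∀ z t i j, HasDerivAt (fun s => U z s i j) ((U z t * A z t) i j) t := by
  have : CompleteSpace (Matrix ι ι ℂ) := FiniteDimensional.complete ℂ _
  obtain ⟨U, hU, h0, hd⟩ := exists_fundamental_solution (a := A)
    (continuous_matrix fun i j => hA i j)
  refine ⟨U, fun i j => hU.matrix_elem i j, h0, fun z t i j => ?_⟩
  exact ((LinearMap.toContinuousLinearMap
    (Matrix.entryLinearMap ℝ ℂ i j)).hasFDerivAt.comp_hasDerivAt t (hd z t))

/-- Existence of evolution operators, jointly continuous in all arguments. If `U` and `V` solve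
`U' = U A` and `V' = -A V` with `U(0) = V(0) = 1`, then `U V` is constant, so that `V = U⁻¹`,
and the evolution operator is `V(ν) U(t)`. -/
theorem exists_isEvolutionOperator [TopologicalSpace Z] [LocallyCompactSpace Z]
    {A : Z → ℝ → Matrix ι ι ℂ} (hA : ∀ i j, Continuous fun p : Z × ℝ => A p.1 p.2 i j) :
    ∃ Φ : Z → ℝ → ℝ → Matrix ι ι ℂ, (∀ z, IsEvolutionOperator (A z) (Φ z)) ∧
      ∀ i j, Continuous fun p : Z × ℝ × ℝ => Φ p.1 p.2.1 p.2.2 i j := by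
  obtain ⟨U, hU, hU0, hUd⟩ := exists_matrix_fundamental_solution hA
  obtain ⟨W, hW, hW0, hWd⟩ := exists_matrix_fundamental_solution
    (A := fun z t => -(A z t).transpose) fun i j => (hA j i).neg
  have hVd (z : Z) (t : ℝ) (i j : ι) :
      HasDerivAt (fun s => (W z s).transpose i j) ((-(A z t * (W z t).transpose)) i j) t := by
    have h := hWd z t j i
    rwa [← Matrix.transpose_apply (W z t * -(A z t).transpose), Matrix.transpose_mul,
      Matrix.transpose_neg, Matrix.transpose_transpose, Matrix.neg_mul] at h
  have hUV (z : Z) (t : ℝ) : U z t * (W z t).transpose = 1 := by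
    rw [matrix_eq_of_hasDerivAt_zero (F := fun t => U z t * (W z t).transpose) _ t 0]
    · simp [hU0, hW0]
    · intro t i j
      convert! hasDerivAt_matrix_mul_apply (hUd z t) (hVd z t) i j using 1
      simp [Matrix.mul_assoc]
  refine ⟨fun z ν t => (W z ν).transpose * U z t, fun z => ⟨fun u t i j => ?_, fun u t i j => ?_,
    fun t => mul_eq_one_comm.1 (hUV z t)⟩, fun i j => ?_⟩
  · convert! hasDerivAt_matrix_mul_apply (F := fun _ => (W z u).transpose) (F' := 0)
      (fun i j => hasDerivAt_const _ _) (hUd z t) i j using 1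
    simp [Matrix.mul_assoc]
  · convert! hasDerivAt_matrix_mul_apply (G := fun _ => U z t) (G' := 0)
      (hVd z u) (fun i j => hasDerivAt_const _ _) i j using 1
    simp [Matrix.mul_assoc]
  · simp only [Matrix.mul_apply, Matrix.transpose_apply]
    refine continuous_finsetSum _ fun l _ => ?_
    exact ((hW l i).comp (f := fun p : Z × ℝ × ℝ => (p.1, p.2.1)) (by fun_prop)).mul
      ((hU l j).comp (f := fun p : Z × ℝ × ℝ => (p.1, p.2.2)) (by fun_prop))

/-- Differentiating `s ↦ Φ(ν, s) Ψ(s, t)` for two evolution operators. -/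
lemma hasDerivAt_evolution_mul {A B : ℝ → Matrix ι ι ℂ} {Φ Ψ : ℝ → ℝ → Matrix ι ι ℂ}
    (hΦ : IsEvolutionOperator A Φ) (hΨ : IsEvolutionOperator B Ψ) (ν t s : ℝ) (i j : ι) :
    HasDerivAt (fun s => (Φ ν s * Ψ s t) i j) ((Φ ν s * (A s - B s) * Ψ s t) i j) s := by
  convert! hasDerivAt_matrix_mul_apply (fun i j => hΦ.deriv_right ν s i j)
    (fun i j => hΨ.deriv_left s t i j) i j using 1
  noncomm_ring

theorem IsEvolutionOperator.unique {A : ℝ → Matrix ι ι ℂ} {Φ Ψ : ℝ → ℝ → Matrix ι ι ℂ}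
    (hΦ : IsEvolutionOperator A Φ) (hΨ : IsEvolutionOperator A Ψ) : Φ = Ψ := by
  funext ν t
  have h := matrix_eq_of_hasDerivAt_zero (F := fun s => Φ ν s * Ψ s t)
    (fun s i j => by simpa using hasDerivAt_evolution_mul hΦ hΨ ν t s i j) t ν
  simpa [hΦ.diag, hΨ.diag] using h

/-- The Duhamel formula, comparing the evolution operators of two coefficient functions. -/
lemma duhamel {A B : ℝ → Matrix ι ι ℂ} {Φ Ψ : ℝ → ℝ → Matrix ι ι ℂ}
    (hΦ : IsEvolutionOperator A Φ) (hΨ : IsEvolutionOperator B Ψ) (ν t : ℝ) (i j : ι)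
    (hc : Continuous fun s => (Φ ν s * (A s - B s) * Ψ s t) i j) :
    Φ ν t i j - Ψ ν t i j = ∫ s in ν..t, (Φ ν s * (A s - B s) * Ψ s t) i j := by
  rw [intervalIntegral.integral_eq_sub_of_hasDerivAt
    (fun s _ => hasDerivAt_evolution_mul hΦ hΨ ν t s i j) (hc.intervalIntegrable _ _)]
  simp [hΦ.diag, hΨ.diag]

end EvolutionOperators

/-! ### Holomorphic dependence of the evolution operator on `z` -/

section Holomorphic

variable {k m : ℕ} {lam mu : ℝ → ℝ}

lemma continuous_Aneg_apply (hmu : Continuous mu) (p q : Phase k m) :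
    Continuous fun t => Aneg mu t p q := by
  obtain ⟨p₁, p₂⟩ := p
  obtain ⟨q₁, q₂⟩ := q
  simp only [Aneg, Matrix.kronecker_apply, completionMatrix, Matrix.of_apply]
  split_ifs <;> fun_prop

lemma continuous_Apos_apply (hlam : Continuous lam) (p q : Phase k m) :
    Continuous fun t => Apos lam t p q := by
  obtain ⟨p₁, p₂⟩ := p
  obtain ⟨q₁, q₂⟩ := q
  simp only [Apos, Matrix.kronecker_apply, completionMatrix, Matrix.of_apply]
  split_ifs <;> fun_prop

lemma continuous_Azero_apply (hlam : Continuous lam) (hmu : Continuous mu) (p q : Phase k m) :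
    Continuous fun t => Azero lam mu t p q := by
  obtain ⟨p₁, p₂⟩ := p
  obtain ⟨q₁, q₂⟩ := q
  simp only [Azero, Matrix.add_apply, Matrix.kronecker_apply, phaseMatrix, Matrix.of_apply]
  split_ifs <;> fun_prop

lemma continuous_Az_apply (hlam : Continuous lam) (hmu : Continuous mu) (p q : Phase k m) :
    Continuous fun x : {z : ℂ // z ≠ 0} × ℝ => Az lam mu (x.1 : ℂ) x.2 p q := by
  simp only [Az, Matrix.add_apply, Matrix.smul_apply, Matrix.map_apply, smul_eq_mul]
  have h1 := continuous_Apos_apply hlam p q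
  have h2 := continuous_Azero_apply hlam hmu p q
  have h3 := continuous_Aneg_apply hmu p q
  have h4 : Continuous fun x : {z : ℂ // z ≠ 0} × ℝ => (x.1 : ℂ)⁻¹ :=
    Continuous.inv₀ (by fun_prop) fun x => x.1.2
  fun_prop

theorem exists_evolution (hlam : Continuous lam) (hmu : Continuous mu) :
    ∃ Φ : ℂ → ℝ → ℝ → Matrix (Phase k m) (Phase k m) ℂ,
      ∀ z, z ≠ 0 → IsEvolutionOperator (Az lam mu z) (Φ z) := by
  classical
  have : LocallyCompactSpace {z : ℂ // z ≠ 0} := isOpen_ne.locallyCompactSpace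
  obtain ⟨Φ, hΦ, -⟩ := exists_isEvolutionOperator (Z := {z : ℂ // z ≠ 0})
    (A := fun z t => Az lam mu (z : ℂ) t) (continuous_Az_apply (k := k) (m := m) hlam hmu)
  refine ⟨fun z => if h : z ≠ 0 then Φ ⟨z, h⟩ else 0, fun z hz => ?_⟩
  simpa [hz] using hΦ ⟨z, hz⟩

variable {Φ : ℂ → ℝ → ℝ → Matrix (Phase k m) (Phase k m) ℂ}

/-- By uniqueness, every choice of evolution operators of `A_z` is jointly continuous in `z ≠ 0`
and both time arguments. -/
theorem continuous_evolution (hlam : Continuous lam) (hmu : Continuous mu)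
    (hΦ : ∀ z, z ≠ 0 → IsEvolutionOperator (Az lam mu z) (Φ z)) (p q : Phase k m) :
    Continuous fun x : {z : ℂ // z ≠ 0} × ℝ × ℝ => Φ (x.1 : ℂ) x.2.1 x.2.2 p q := by
  have : LocallyCompactSpace {z : ℂ // z ≠ 0} := isOpen_ne.locallyCompactSpace
  obtain ⟨Ψ, hΨ, hc⟩ := exists_isEvolutionOperator (Z := {z : ℂ // z ≠ 0})
    (A := fun z t => Az lam mu (z : ℂ) t) (continuous_Az_apply (k := k) (m := m) hlam hmu)
  convert! hc p q using 6 with x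
  exact (hΦ x.1 x.1.2).unique (hΨ x.1)

lemma Az_sub_Az {z w : ℂ} (hz : z ≠ 0) (hw : w ≠ 0) (t : ℝ) :
    (Az lam mu z t - Az lam mu w t : Matrix (Phase k m) (Phase k m) ℂ) =
      (z - w) • ((Apos lam t).map Complex.ofReal - (z * w)⁻¹ • (Aneg mu t).map Complex.ofReal) := by
  ext p q
  simp only [Az, Matrix.add_apply, Matrix.smul_apply, Matrix.map_apply, smul_eq_mul,
    Matrix.sub_apply]
  field_simp
  ring

/-- By the Duhamel formula, the difference quotients of `z ↦ Φ(z, ν, t)` are integrals that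
depend continuously on `z`. -/
theorem differentiableOn_evolution (hlam : Continuous lam) (hmu : Continuous mu)
    (hΦ : ∀ z, z ≠ 0 → IsEvolutionOperator (Az lam mu z) (Φ z)) (ν t : ℝ) (p q : Phase k m) :
    DifferentiableOn ℂ (fun z => Φ z ν t p q) {0}ᶜ := by
  intro w hw
  have hw : w ≠ 0 := hw
  refine DifferentiableAt.differentiableWithinAt ?_
  set h : {z : ℂ // z ≠ 0} → ℝ → ℂ := fun z s =>
    (Φ (z : ℂ) ν s * ((Apos lam s).map Complex.ofReal -
      ((z : ℂ) * w)⁻¹ • (Aneg mu s).map Complex.ofReal) * Φ w s t :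
        Matrix (Phase k m) (Phase k m) ℂ) p q with hh
  have hc : Continuous h.uncurry := by
    have h1 (p q : Phase k m) : Continuous fun x : {z : ℂ // z ≠ 0} × ℝ => Φ (x.1 : ℂ) ν x.2 p q :=
      (continuous_evolution hlam hmu hΦ p q).comp
        (f := fun x : {z : ℂ // z ≠ 0} × ℝ => (x.1, ν, x.2)) (by fun_prop)
    have h2 (p q : Phase k m) : Continuous fun x : {z : ℂ // z ≠ 0} × ℝ => Φ w x.2 t p q :=
      (continuous_evolution hlam hmu hΦ p q).comp
        (f := fun x : {z : ℂ // z ≠ 0} × ℝ => ((⟨w, hw⟩ : {z : ℂ // z ≠ 0}), x.2, t)) (by fun_prop)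
    have h3 (p q : Phase k m) := continuous_Apos_apply hlam p q
    have h4 (p q : Phase k m) := continuous_Aneg_apply hmu p q
    have h5 : Continuous fun x : {z : ℂ // z ≠ 0} × ℝ => ((x.1 : ℂ) * w)⁻¹ :=
      Continuous.inv₀ (by fun_prop) fun x => mul_ne_zero x.1.2 hw
    simp only [hh, Function.uncurry_def, Matrix.mul_apply, Matrix.sub_apply, Matrix.smul_apply,
      Matrix.map_apply, smul_eq_mul]
    refine continuous_finsetSum _ fun l _ => Continuous.mul
      (continuous_finsetSum _ fun l' _ => (h1 p l').mul (Continuous.sub ?_ (h5.mul ?_))) (h2 l q)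
    · exact Complex.continuous_ofReal.comp ((h3 l' l).comp continuous_snd)
    · exact Complex.continuous_ofReal.comp ((h4 l' l).comp continuous_snd)
  clear_value h
  set g : {z : ℂ // z ≠ 0} → ℂ := fun z => ∫ s in ν..t, h z s with hg
  have hgc : Continuous g := by
    exact intervalIntegral.continuous_parametric_intervalIntegral_of_continuous' hc ν t
  have key (z : {z : ℂ // z ≠ 0}) : Φ z ν t p q - Φ w ν t p q = (z - w) * g z := by
    have e : (fun s => (Φ (z : ℂ) ν s * (Az lam mu z s - Az lam mu w s) * Φ w s t :
        Matrix (Phase k m) (Phase k m) ℂ) p q) =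
        fun s => (z - w) * h z s := by
      funext s
      rw [hh, Az_sub_Az z.2 hw, Matrix.mul_smul, Matrix.smul_mul, Matrix.smul_apply, smul_eq_mul]
    have hzc : Continuous (h z) := hc.uncurry_left z
    rw [duhamel (hΦ z z.2) (hΦ w hw) ν t p q (by rw [e]; exact continuous_const.mul hzc), e,
      intervalIntegral.integral_const_mul]
  refine HasDerivAt.differentiableAt (f' := g ⟨w, hw⟩) ?_
  rw [hasDerivAt_iff_tendsto_slope]
  have hlim : Tendsto (fun z : ℂ => if hz : z ≠ 0 then g ⟨z, hz⟩ else 0) (𝓝[≠] w)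
      (𝓝 (g ⟨w, hw⟩)) := by
    refine Tendsto.mono_left ?_ nhdsWithin_le_nhds
    have hemb : IsOpenEmbedding (Subtype.val : {z : ℂ // z ≠ 0} → ℂ) :=
      isOpen_ne.isOpenEmbedding_subtypeVal
    have := hemb.map_nhds_eq ⟨w, hw⟩
    simp only at this
    rw [← this, tendsto_map'_iff]
    refine (hgc.tendsto _).congr fun z => ?_
    simp [z.2]
  refine hlim.congr' ?_
  filter_upwards [self_mem_nhdsWithin, nhdsWithin_le_nhds (isOpen_ne.mem_nhds hw)] with z hz hz0
  have hz0 : z ≠ 0 := hz0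
  have hzw : z - w ≠ 0 := sub_ne_zero.2 hz
  rw [dif_pos hz0, slope_def_field, key ⟨z, hz0⟩]
  field_simp

end Holomorphic

/-! ### Laurent coefficients -/

/-- The coefficient of `zⁿ` in the Laurent series of a scalar function on the punctured plane. -/
noncomputable def scalarCoeff (n : ℤ) (f : ℂ → ℂ) : ℂ :=
  (2 * Real.pi * Complex.I : ℂ)⁻¹ * ∮ z in C(0, 1), z ^ (-n - 1) * f z

lemma laurentCoeff_apply {ι : Type*} (n : ℤ) (F : ℂ → Matrix ι ι ℂ) (i j : ι) :
    laurentCoeff n F i j = scalarCoeff n fun z => F z i j := rfl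

section LaurentSeries

variable {f : ℂ → ℂ}

lemma differentiableOn_zpow_mul (hf : DifferentiableOn ℂ f {0}ᶜ) (n : ℤ) :
    DifferentiableOn ℂ (fun z => z ^ n * f z) {0}ᶜ := fun z hz =>
  ((differentiableAt_zpow.2 (Or.inl hz)).differentiableWithinAt).mul (hf z hz)

lemma circleIntegral_eq_of_le {g : ℂ → ℂ} (hg : DifferentiableOn ℂ g {0}ᶜ) {r R : ℝ} (hr : 0 < r)
    (hrR : r ≤ R) : (∮ z in C(0, R), g z) = ∮ z in C(0, r), g z := by
  refine Complex.circleIntegral_eq_of_differentiable_on_annulus_off_countable hr hrR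
    Set.countable_empty (hg.continuousOn.mono ?_) fun z hz => ?_
  · rintro z ⟨-, hz⟩ rfl
    exact hz (by simpa using hr)
  · refine (hg z ?_).differentiableAt (isOpen_compl_singleton.mem_nhds ?_) <;>
    · rintro rfl
      exact hz.1.2 (by simpa using hr.le)

/-- The Laurent coefficients may be computed on any circle around the origin. -/
lemma scalarCoeff_eq (hf : DifferentiableOn ℂ f {0}ᶜ) (n : ℤ) {R : ℝ} (hR : 0 < R) :
    scalarCoeff n f = (2 * Real.pi * Complex.I : ℂ)⁻¹ * ∮ z in C(0, R), z ^ (-n - 1) * f z := by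
  have h := differentiableOn_zpow_mul hf (-n - 1)
  rcases le_total 1 R with h1 | h1
  · rw [circleIntegral_eq_of_le h one_pos h1, scalarCoeff]
  · rw [← circleIntegral_eq_of_le h hR h1, scalarCoeff]

lemma exists_norm_scalarCoeff_le (hf : DifferentiableOn ℂ f {0}ᶜ) {R : ℝ} (hR : 0 < R) :
    ∃ M, ∀ n, ‖scalarCoeff n f‖ ≤ M * R ^ (-n) := by
  obtain ⟨M, hM⟩ := (isCompact_sphere (0 : ℂ) R).exists_bound_of_continuousOn
    (hf.continuousOn.mono fun z hz => by
      rintro rfl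
      simp [hR.ne] at hz)
  refine ⟨M, fun n => ?_⟩
  rw [scalarCoeff_eq hf n hR, ← smul_eq_mul]
  refine (circleIntegral.norm_two_pi_i_inv_smul_integral_le_of_norm_le_const
    (C := R ^ (-n - 1) * M) hR.le fun z hz => ?_).trans_eq ?_
  · rw [norm_mul, norm_zpow, mem_sphere_zero_iff_norm.1 hz]
    exact mul_le_mul_of_nonneg_left (hM z hz) (by positivity)
  · rw [zpow_sub_one₀ hR.ne']
    field_simp

lemma summable_scalarCoeff (hf : DifferentiableOn ℂ f {0}ᶜ) {R : ℝ} (hR : 0 < R) :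
    Summable fun n : ℤ => R ^ n * ‖scalarCoeff n f‖ := by
  have hgeom : Summable fun n : ℕ => ((1 : ℝ) / 2) ^ n := summable_geometric_two
  refine Summable.of_nat_of_neg ?_ ?_
  -- the coefficients of positive index are estimated on the circle of radius `2 R`,
  -- those of negative index on the circle of radius `R / 2`
  · obtain ⟨M, hM⟩ := exists_norm_scalarCoeff_le hf (R := 2 * R) (by positivity)
    refine .of_nonneg_of_le (fun n => by positivity) (fun n => ?_) (hgeom.mul_left M)
    refine (mul_le_mul_of_nonneg_left (hM n) (by positivity)).trans_eq ?_
    rw [zpow_neg, mul_zpow, zpow_natCast, zpow_natCast, one_div, inv_pow]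
    field_simp
  · obtain ⟨M, hM⟩ := exists_norm_scalarCoeff_le hf (R := R / 2) (by positivity)
    refine .of_nonneg_of_le (fun n => by positivity) (fun n => ?_) (hgeom.mul_left M)
    refine (mul_le_mul_of_nonneg_left (hM _) (by positivity)).trans_eq ?_
    rw [zpow_neg, neg_neg, div_zpow, zpow_natCast, zpow_natCast, one_div, inv_pow]
    field_simp

/-- A function holomorphic on the punctured plane is the sum of its Laurent series: on each circle
the Laurent series is the Fourier series, which converges absolutely. -/
theorem hasSum_laurent (hf : DifferentiableOn ℂ f {0}ᶜ) {z : ℂ} (hz : z ≠ 0) :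
    HasSum (fun n : ℤ => z ^ n * scalarCoeff n f) (f z) := by
  have hT : Fact (0 < 2 * Real.pi) := ⟨Real.two_pi_pos⟩
  have hR : 0 < ‖z‖ := norm_pos_iff.2 hz
  have hR0 : (‖z‖ : ℂ) ≠ 0 := by exact_mod_cast hR.ne'
  let g : C(AddCircle (2 * Real.pi), ℂ) :=
    ⟨fun x => f (‖z‖ * AddCircle.toCircle x), by
      refine hf.continuousOn.comp_continuous ?_ fun x => ?_
      · exact continuous_const.mul (continuous_subtype_val.comp AddCircle.continuous_toCircle)
      · exact mul_ne_zero hR0 (Circle.coe_ne_zero _)⟩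
  have hcircle (θ : ℝ) : ((AddCircle.toCircle (θ : AddCircle (2 * Real.pi)) : Circle) : ℂ) =
      Complex.exp (θ * Complex.I) := by
    rw [AddCircle.toCircle_apply_mk, Circle.coe_exp]
    congr 2
    push_cast
    field_simp
  have hfour (n : ℤ) (θ : ℝ) : fourier n (θ : AddCircle (2 * Real.pi)) =
      Complex.exp (θ * Complex.I) ^ n := by
    rw [fourier_apply, AddCircle.toCircle_zsmul, Circle.coe_zpow, hcircle]
  have hcoeff (n : ℤ) : fourierCoeff g n = (‖z‖ : ℂ) ^ n * scalarCoeff n f := by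
    have hint : (∮ w in C(0, ‖z‖), w ^ (-n - 1) * f w) = Complex.I * (‖z‖ : ℂ) ^ (-n) *
        ∫ θ in (0 : ℝ)..2 * Real.pi, fourier (-n) (θ : AddCircle (2 * Real.pi)) • g θ := by
      rw [circleIntegral, ← intervalIntegral.integral_const_mul]
      refine intervalIntegral.integral_congr fun θ _ => ?_
      have hg : g (θ : AddCircle (2 * Real.pi)) = f (circleMap 0 ‖z‖ θ) := by
        change f (‖z‖ * AddCircle.toCircle (θ : AddCircle (2 * Real.pi))) = _
        rw [hcircle, circleMap, zero_add]
      have he := Complex.exp_ne_zero (θ * Complex.I)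
      simp only [hg, hfour, deriv_circleMap, smul_eq_mul]
      rw [circleMap, zero_add, mul_zpow, zpow_sub_one₀ hR0, zpow_sub_one₀ he]
      field_simp
    rw [scalarCoeff_eq hf n hR, hint, fourierCoeff_eq_intervalIntegral g n 0, zero_add,
      Complex.real_smul, zpow_neg]
    push_cast
    have := Real.pi_ne_zero
    field_simp
  have hsumm : Summable (fourierCoeff g) := by
    refine Summable.of_norm ?_
    simpa [hcoeff] using summable_scalarCoeff hf hR
  have key := has_pointwise_sum_fourier_series_of_summable hsumm (z.arg : AddCircle (2 * Real.pi))
  have hpolar : (‖z‖ : ℂ) * Complex.exp (z.arg * Complex.I) = z := Complex.norm_mul_exp_arg_mul_I z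
  convert! key using 1
  · funext n
    rw [hcoeff, hfour, smul_eq_mul]
    nth_rewrite 1 [← hpolar]
    rw [mul_zpow]
    ring
  · change f z = f (‖z‖ * AddCircle.toCircle (z.arg : AddCircle (2 * Real.pi)))
    rw [hcircle, hpolar]

end LaurentSeries

section CoefficientCalculus

lemma circleIntegrable_zpow_mul {f : ℂ → ℂ} (hf : DifferentiableOn ℂ f {0}ᶜ) (n : ℤ) :
    CircleIntegrable (fun z => z ^ n * f z) 0 1 :=
  ((differentiableOn_zpow_mul hf n).continuousOn.mono fun z hz => by
    rintro rfl
    simp at hz).circleIntegrable zero_le_one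

lemma scalarCoeff_add {f g : ℂ → ℂ} (hf : DifferentiableOn ℂ f {0}ᶜ)
    (hg : DifferentiableOn ℂ g {0}ᶜ) (n : ℤ) :
    scalarCoeff n (fun z => f z + g z) = scalarCoeff n f + scalarCoeff n g := by
  simp only [scalarCoeff, mul_add]
  rw [circleIntegral.integral_add (circleIntegrable_zpow_mul hf _)
    (circleIntegrable_zpow_mul hg _), mul_add]

lemma scalarCoeff_const_mul (c : ℂ) (f : ℂ → ℂ) (n : ℤ) :
    scalarCoeff n (fun z => c * f z) = c * scalarCoeff n f := by
  simp only [scalarCoeff, mul_left_comm _ c, circleIntegral.integral_const_mul]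

lemma scalarCoeff_sum {ι : Type*} (s : Finset ι) {f : ι → ℂ → ℂ}
    (hf : ∀ i, DifferentiableOn ℂ (f i) {0}ᶜ) (n : ℤ) :
    scalarCoeff n (fun z => ∑ i ∈ s, f i z) = ∑ i ∈ s, scalarCoeff n (f i) := by
  classical
  induction s using Finset.induction_on with
  | empty => simp [scalarCoeff, circleIntegral]
  | insert i s hi ih =>
    simp only [Finset.sum_insert hi]
    rw [scalarCoeff_add (hf i) (DifferentiableOn.fun_sum fun i _ => hf i), ih]

lemma scalarCoeff_congr {f g : ℂ → ℂ} (h : ∀ z, z ≠ 0 → f z = g z) (n : ℤ) :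
    scalarCoeff n f = scalarCoeff n g := by
  unfold scalarCoeff
  congr 1
  refine circleIntegral.integral_congr zero_le_one fun z hz => ?_
  have hz : z ≠ 0 := by
    rintro rfl
    simp at hz
  simp only [h z hz]

lemma scalarCoeff_mul_zpow (f : ℂ → ℂ) (l n : ℤ) :
    scalarCoeff n (fun z => z ^ l * f z) = scalarCoeff (n - l) f := by
  unfold scalarCoeff
  congr 1
  refine circleIntegral.integral_congr zero_le_one fun z hz => ?_
  have hz : z ≠ 0 := by
    rintro rfl
    simp at hz
  simp only
  rw [← mul_assoc, ← zpow_add₀ hz]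
  congr 2
  ring

lemma scalarCoeff_const (c : ℂ) (n : ℤ) :
    scalarCoeff n (fun _ => c) = if n = 0 then c else 0 := by
  have h : (∮ z in C(0, 1), z ^ (-n - 1) * c) = (∮ z in C(0, 1), (z - 0) ^ (-n - 1)) * c := by
    simp_rw [mul_comm _ c, circleIntegral.integral_const_mul, sub_zero]
  rw [scalarCoeff, h]
  split_ifs with hn
  · have : (∮ z : ℂ in C(0, 1), (z - 0) ^ (-n - 1)) = 2 * Real.pi * Complex.I := by
      rw [← circleIntegral.integral_sub_center_inv 0 one_ne_zero, hn]
      simp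
    rw [this]
    have := Complex.two_pi_I_ne_zero
    field_simp
  · rw [circleIntegral.integral_sub_zpow_of_ne (by omega)]
    simp

/-- Differentiation of a Laurent coefficient with respect to a parameter. -/
lemma hasDerivAt_scalarCoeff {F F' : ℂ → ℝ → ℂ} (n : ℤ)
    (hF : ∀ ν, DifferentiableOn ℂ (fun z => F z ν) {0}ᶜ)
    (hF' : Continuous fun x : {z : ℂ // z ≠ 0} × ℝ => F' (x.1 : ℂ) x.2)
    (hd : ∀ z, z ≠ 0 → ∀ ν, HasDerivAt (F z) (F' z ν) ν) (ν : ℝ) :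
    HasDerivAt (fun ν => scalarCoeff n fun z => F z ν) (scalarCoeff n fun z => F' z ν) ν := by
  have hc0 (θ : ℝ) : circleMap 0 1 θ ≠ 0 := circleMap_ne_center one_ne_zero
  set w : ℝ → ℂ := fun θ => deriv (circleMap 0 1) θ * circleMap 0 1 θ ^ (-n - 1) with hw
  have hwc : Continuous w := by
    have h1 : Continuous (deriv (circleMap 0 1)) := by
      have : deriv (circleMap 0 1) = fun θ => circleMap 0 1 θ * Complex.I := by
        funext θ
        simp
      rw [this]
      fun_prop
    exact h1.mul ((continuous_circleMap 0 1).zpow₀ _ fun θ => Or.inl (hc0 θ))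
  have hGc : Continuous fun x : ℝ × ℝ => w x.2 * F' (circleMap 0 1 x.2) x.1 := by
    refine (hwc.comp continuous_snd).mul (hF'.comp (f := fun x : ℝ × ℝ =>
      ((⟨circleMap 0 1 x.2, hc0 x.2⟩ : {z : ℂ // z ≠ 0}), x.1)) ?_)
    refine Continuous.prodMk (Continuous.subtype_mk ?_ _) continuous_fst
    fun_prop
  obtain ⟨C, hC⟩ := ((isCompact_closedBall ν 1).prod
    (isCompact_Icc (a := (0 : ℝ)) (b := 2 * Real.pi))).exists_bound_of_continuousOn
      hGc.continuousOn
  have hFc (ν : ℝ) : Continuous fun θ => w θ * F (circleMap 0 1 θ) ν :=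
    hwc.mul ((hF ν).continuousOn.comp_continuous (continuous_circleMap 0 1) hc0)
  have key := (intervalIntegral.hasDerivAt_integral_of_dominated_loc_of_deriv_le
    (μ := volume) (a := 0) (b := 2 * Real.pi) (x₀ := ν) (bound := fun _ => C)
    (F := fun ν θ => w θ * F (circleMap 0 1 θ) ν) (F' := fun ν θ => w θ * F' (circleMap 0 1 θ) ν)
    (Metric.closedBall_mem_nhds ν one_pos)
    (Eventually.of_forall fun ν => (hFc ν).aestronglyMeasurable)
    ((hFc ν).intervalIntegrable _ _)
    ((hGc.comp (by fun_prop : Continuous fun θ : ℝ => (ν, θ))).aestronglyMeasurable)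
    (ae_of_all _ fun θ hθ x hx => hC (x, θ) ⟨hx, by
      rw [Set.uIoc_of_le Real.two_pi_pos.le] at hθ
      exact Set.Ioc_subset_Icc_self hθ⟩)
    intervalIntegrable_const
    (ae_of_all _ fun θ _ x _ => (hd _ (hc0 θ) x).const_mul _)).2
  have e (f : ℂ → ℂ) : scalarCoeff n f = (2 * Real.pi * Complex.I : ℂ)⁻¹ *
      ∫ θ in (0 : ℝ)..2 * Real.pi, w θ * f (circleMap 0 1 θ) := by
    simp only [scalarCoeff, circleIntegral, hw, smul_eq_mul, mul_assoc]
  simp only [e]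
  exact key.const_mul _

end CoefficientCalculus

/-! ### Laurent coefficients of the evolution operator -/

section EvolutionCoefficients

variable {k m : ℕ} {lam mu : ℝ → ℝ} {Φ : ℂ → ℝ → ℝ → Matrix (Phase k m) (Phase k m) ℂ}

theorem hasSum_laurentCoeff (hlam : Continuous lam) (hmu : Continuous mu)
    (hΦ : ∀ z, z ≠ 0 → IsEvolutionOperator (Az lam mu z) (Φ z)) (ν t : ℝ) {z : ℂ} (hz : z ≠ 0) :
    HasSum (fun n : ℤ => z ^ n • laurentCoeff n (fun w => Φ w ν t)) (Φ z ν t) :=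
  Pi.hasSum.2 fun p => Pi.hasSum.2 fun q =>
    hasSum_laurent (differentiableOn_evolution hlam hmu hΦ ν t p q) hz

lemma laurentCoeff_diag (hΦ : ∀ z, z ≠ 0 → IsEvolutionOperator (Az lam mu z) (Φ z)) (t : ℝ)
    (n : ℤ) : laurentCoeff n (fun z => Φ z t t) = if n = 0 then 1 else 0 := by
  ext p q
  rw [laurentCoeff_apply, scalarCoeff_congr (g := fun _ => (1 : Matrix _ _ ℂ) p q)
    (fun z hz => by rw [(hΦ z hz).diag]), scalarCoeff_const]
  split_ifs <;> rfl

/-- The coefficient of `zⁿ` in `A_z(ν) Φ(z, ν, t)`. -/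
noncomputable def convCoeff (lam mu : ℝ → ℝ)
    (Φ : ℂ → ℝ → ℝ → Matrix (Phase k m) (Phase k m) ℂ) (n : ℤ) (ν t : ℝ) :
    Matrix (Phase k m) (Phase k m) ℂ :=
  (Aneg mu ν).map Complex.ofReal * laurentCoeff (n + 1) (fun z => Φ z ν t) +
    (Azero lam mu ν).map Complex.ofReal * laurentCoeff n (fun z => Φ z ν t) +
    (Apos lam ν).map Complex.ofReal * laurentCoeff (n - 1) (fun z => Φ z ν t)

lemma volterraKernel_eq (lam mu : ℝ → ℝ)
    (Φ : ℂ → ℝ → ℝ → Matrix (Phase k m) (Phase k m) ℂ) (ν t : ℝ) :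
    volterraKernel lam mu Φ ν t = convCoeff lam mu Φ 0 ν t := rfl

lemma scalarCoeff_Az_mul (hlam : Continuous lam) (hmu : Continuous mu)
    (hΦ : ∀ z, z ≠ 0 → IsEvolutionOperator (Az lam mu z) (Φ z)) (n : ℤ) (ν t : ℝ)
    (p q : Phase k m) :
    scalarCoeff n (fun z => (Az lam mu z ν * Φ z ν t : Matrix (Phase k m) (Phase k m) ℂ) p q) =
      convCoeff lam mu Φ n ν t p q := by
  have hd (l : ℤ) (r : Phase k m) : DifferentiableOn ℂ (fun z => z ^ l * Φ z ν t r q) {0}ᶜ :=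
    differentiableOn_zpow_mul (differentiableOn_evolution hlam hmu hΦ ν t r q) l
  let a : ℤ → Matrix (Phase k m) (Phase k m) ℝ := fun l =>
    if l = -1 then Aneg mu ν else if l = 0 then Azero lam mu ν else Apos lam ν
  have ha : a (-1) = Aneg mu ν ∧ a 0 = Azero lam mu ν ∧ a 1 = Apos lam ν := by simp [a]
  have hda (l : ℤ) (r : Phase k m) :
      DifferentiableOn ℂ (fun z => (a l p r : ℂ) * (z ^ l * Φ z ν t r q)) {0}ᶜ :=
    (hd l r).const_mul _
  have hda2 (r : Phase k m) : DifferentiableOn ℂ (fun z =>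
      (a (-1) p r : ℂ) * (z ^ (-1 : ℤ) * Φ z ν t r q) +
        (a 0 p r : ℂ) * (z ^ (0 : ℤ) * Φ z ν t r q)) {0}ᶜ := (hda _ r).add (hda _ r)
  rw [scalarCoeff_congr (g := fun z => ∑ r, ((a (-1) p r : ℂ) * (z ^ (-1 : ℤ) * Φ z ν t r q) +
    (a 0 p r : ℂ) * (z ^ (0 : ℤ) * Φ z ν t r q) +
    (a 1 p r : ℂ) * (z ^ (1 : ℤ) * Φ z ν t r q)))]
  · rw [scalarCoeff_sum _ fun r => (hda2 r).fun_add (hda 1 r)]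
    simp only [convCoeff, Matrix.add_apply, Matrix.mul_apply, ← Finset.sum_add_distrib]
    refine Finset.sum_congr rfl fun r _ => ?_
    rw [scalarCoeff_add (hda2 r) (hda 1 r), scalarCoeff_add (hda _ r) (hda _ r)]
    simp only [ha, scalarCoeff_const_mul, scalarCoeff_mul_zpow, laurentCoeff_apply,
      Matrix.map_apply, sub_neg_eq_add, sub_zero]
  · intro z _
    simp only [Matrix.mul_apply, Az, Matrix.add_apply, Matrix.smul_apply, Matrix.map_apply,
      smul_eq_mul, zpow_neg, zpow_one, zpow_zero, ha]
    refine Finset.sum_congr rfl fun r _ => ?_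
    ring

/-- The backward equation for the Laurent coefficients. -/
theorem hasDerivAt_laurentCoeff (hlam : Continuous lam) (hmu : Continuous mu)
    (hΦ : ∀ z, z ≠ 0 → IsEvolutionOperator (Az lam mu z) (Φ z)) (n : ℤ) (ν t : ℝ)
    (p q : Phase k m) :
    HasDerivAt (fun ν => laurentCoeff n (fun z => Φ z ν t) p q)
      (-convCoeff lam mu Φ n ν t p q) ν := by
  have hc : Continuous fun x : {z : ℂ // z ≠ 0} × ℝ =>
      (-(Az lam mu (x.1 : ℂ) x.2 * Φ (x.1 : ℂ) x.2 t) : Matrix (Phase k m) (Phase k m) ℂ) p q := by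
    simp only [Matrix.neg_apply, Matrix.mul_apply]
    refine (continuous_finsetSum _ fun r _ => (continuous_Az_apply hlam hmu p r).mul ?_).neg
    exact (continuous_evolution hlam hmu hΦ r q).comp
      (f := fun x : {z : ℂ // z ≠ 0} × ℝ => (x.1, x.2, t)) (by fun_prop)
  convert! hasDerivAt_scalarCoeff (F := fun z ν => Φ z ν t p q)
    (F' := fun z ν => (-(Az lam mu z ν * Φ z ν t) : Matrix (Phase k m) (Phase k m) ℂ) p q) n
    (fun ν => differentiableOn_evolution hlam hmu hΦ ν t p q) hc
    (fun z hz ν => (hΦ z hz).deriv_left ν t p q) ν using 1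
  rw [← scalarCoeff_Az_mul hlam hmu hΦ, neg_eq_neg_one_mul, ← scalarCoeff_const_mul]
  simp

lemma continuous_laurentCoeff (hlam : Continuous lam) (hmu : Continuous mu)
    (hΦ : ∀ z, z ≠ 0 → IsEvolutionOperator (Az lam mu z) (Φ z)) (n : ℤ) (t : ℝ)
    (p q : Phase k m) : Continuous fun ν => laurentCoeff n (fun z => Φ z ν t) p q :=
  continuous_iff_continuousAt.2 fun ν =>
    (hasDerivAt_laurentCoeff hlam hmu hΦ n ν t p q).continuousAt

/-- The Laurent coefficients of the evolution operator are bounded on compact time intervals,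
uniformly in the index. -/
lemma exists_norm_laurentCoeff_le (hlam : Continuous lam) (hmu : Continuous mu)
    (hΦ : ∀ z, z ≠ 0 → IsEvolutionOperator (Az lam mu z) (Φ z)) (u t : ℝ) (p q : Phase k m) :
    ∃ C, ∀ n, ∀ ν ∈ Set.Icc u t, ‖laurentCoeff n (fun z => Φ z ν t) p q‖ ≤ C := by
  have hK : IsCompact {z : {z : ℂ // z ≠ 0} | ‖(z : ℂ)‖ = 1} := by
    rw [Subtype.isCompact_iff]
    convert! isCompact_sphere (0 : ℂ) 1
    ext z
    simp only [Set.mem_image, Set.mem_ofPred_eq, Subtype.exists, mem_sphere_zero_iff_norm]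
    constructor
    · rintro ⟨w, _, hw, rfl⟩
      exact hw
    · intro hz
      exact ⟨z, by rintro rfl; simp at hz, hz, rfl⟩
  obtain ⟨C, hC⟩ := (hK.prod (isCompact_Icc (a := u) (b := t))).exists_bound_of_continuousOn
    ((continuous_evolution hlam hmu hΦ p q).comp
      (f := fun x : {z : ℂ // z ≠ 0} × ℝ => (x.1, x.2, t)) (by fun_prop)).continuousOn
  refine ⟨1 * C, fun n ν hν => ?_⟩
  rw [laurentCoeff_apply, scalarCoeff, ← smul_eq_mul]
  refine circleIntegral.norm_two_pi_i_inv_smul_integral_le_of_norm_le_const zero_le_one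
    fun z hz => ?_
  have hz1 := mem_sphere_zero_iff_norm.1 hz
  have hz0 : z ≠ 0 := by
    rintro rfl
    simp at hz1
  rw [norm_mul, norm_zpow, hz1, one_zpow, one_mul]
  exact hC (⟨z, hz0⟩, ν) ⟨hz1, hν⟩

lemma tendsto_laurentCoeff (hlam : Continuous lam) (hmu : Continuous mu)
    (hΦ : ∀ z, z ≠ 0 → IsEvolutionOperator (Az lam mu z) (Φ z)) (ν t : ℝ) (p q : Phase k m) :
    Tendsto (fun n : ℤ => laurentCoeff n (fun z => Φ z ν t) p q) cofinite (𝓝 0) := by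
  have h := (hasSum_laurent (differentiableOn_evolution hlam hmu hΦ ν t p q) one_ne_zero).summable
  simpa using! h.tendsto_cofinite_zero

end EvolutionCoefficients

/-! ### The chain stopped at the first passage -/

section Paths

variable {k m : ℕ} {Ω : Type*}

/-- The first passage time, capped at `t`. -/
noncomputable def stopTime (X : ℝ → Ω → State k m) (u t : ℝ) (ω : Ω) : ℝ :=
  (min (firstPassage X u ω) (t : EReal)).toReal

/-- The chain stopped at the first passage to the empty system. -/
noncomputable def stoppedChain (X : ℝ → Ω → State k m) (u t : ℝ) (ω : Ω) : State k m :=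
  X (stopTime X u t ω) ω

variable {X : ℝ → Ω → State k m} {u : ℝ} {ω : Ω}

lemma le_firstPassage : (u : EReal) ≤ firstPassage X u ω := by
  refine le_sInf ?_
  rintro x ⟨t, rfl, hut, -⟩
  exact_mod_cast hut.le

lemma coe_toReal_firstPassage {t : ℝ} (h : firstPassage X u ω ≤ t) :
    ((firstPassage X u ω).toReal : EReal) = firstPassage X u ω :=
  EReal.coe_toReal (h.trans_lt (EReal.coe_lt_top t)).ne
    ((EReal.bot_lt_coe u).trans_le le_firstPassage).ne'

lemma stopTime_of_le {t : ℝ} (h : firstPassage X u ω ≤ t) :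
    stopTime X u t ω = (firstPassage X u ω).toReal := by
  rw [stopTime, min_eq_left h]

lemma stopTime_of_ge {t : ℝ} (h : t ≤ firstPassage X u ω) : stopTime X u t ω = t := by
  rw [stopTime, min_eq_right h, EReal.toReal_coe]

lemma coe_stopTime (X : ℝ → Ω → State k m) (u t : ℝ) (ω : Ω) :
    (stopTime X u t ω : EReal) = min (firstPassage X u ω) t := by
  rcases le_total (firstPassage X u ω) t with h | h
  · rw [stopTime_of_le h, min_eq_left h, coe_toReal_firstPassage h]
  · rw [stopTime_of_ge h, min_eq_right h]

lemma stopTime_le (X : ℝ → Ω → State k m) (u t : ℝ) (ω : Ω) : stopTime X u t ω ≤ t := by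
  have h := coe_stopTime X u t ω
  exact_mod_cast h.trans_le (min_le_right _ _)

lemma le_stopTime {t : ℝ} (hut : u ≤ t) : u ≤ stopTime X u t ω := by
  have h : (u : EReal) ≤ stopTime X u t ω := by
    rw [coe_stopTime]
    exact le_min le_firstPassage (by exact_mod_cast hut)
  exact_mod_cast h

/-- By right-continuity, the system is empty at the first passage time. -/
lemma exists_eq_inl_firstPassage
    (hrc : ∀ t, u ≤ t → ∀ᶠ s in 𝓝[>] t, X s ω = X t ω) {t : ℝ}
    (h : firstPassage X u ω ≤ t) :
    ∃ a, X (firstPassage X u ω).toReal ω = Sum.inl a := by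
  have hT := coe_toReal_firstPassage h
  set T := (firstPassage X u ω).toReal
  have huT : u ≤ T := by
    have := le_firstPassage (X := X) (u := u) (ω := ω)
    rw [← hT] at this
    exact_mod_cast this
  obtain ⟨b, hb, hTb⟩ := mem_nhdsGT_iff_exists_Ioo_subset.1 (hrc T huT)
  have hlt : firstPassage X u ω < (b : EReal) := by
    rw [← hT]
    exact_mod_cast hb
  obtain ⟨_, ⟨s, rfl, hus, a, ha⟩, hsb⟩ := sInf_lt_iff.1 hlt
  have hTs : T ≤ s := by
    have : firstPassage X u ω ≤ s := sInf_le ⟨s, rfl, hus, a, ha⟩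
    rw [← hT] at this
    exact_mod_cast this
  refine ⟨a, ?_⟩
  rcases hTs.eq_or_lt with rfl | hTs
  · exact ha
  · exact (hTb ⟨hTs, by exact_mod_cast hsb⟩).symm.trans ha

lemma ne_inl_of_lt_firstPassage
    (hrc : ∀ t, u ≤ t → ∀ᶠ s in 𝓝[>] t, X s ω = X t ω) {r : ℝ}
    (hur : u ≤ r) (h : (r : EReal) < firstPassage X u ω)
    (a : Fin k) : X r ω ≠ Sum.inl a := by
  intro ha
  rcases hur.eq_or_lt with rfl | hur
  · -- an empty system at time `u` stays empty for a while, so that `τ = u`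
    obtain ⟨b, hb, hub⟩ := mem_nhdsGT_iff_exists_Ioo_subset.1 (hrc u le_rfl)
    obtain ⟨s, hus, hs⟩ := EReal.lt_iff_exists_real_btwn.1
      (lt_min h (by exact_mod_cast hb : (u : EReal) < (b : EReal)))
    have hus : u < s := by exact_mod_cast hus
    have hsb : s < b := by exact_mod_cast hs.trans_le (min_le_right _ _)
    have : firstPassage X u ω ≤ s := sInf_le ⟨s, rfl, hus, a, (hub ⟨hus, hsb⟩ : _ = _).trans ha⟩
    exact absurd (hs.trans_le (min_le_left _ _)) this.not_gt
  · exact absurd h (sInf_le ⟨r, rfl, hur, a, ha⟩ : firstPassage X u ω ≤ r).not_gt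

lemma stoppedChain_of_lt {r : ℝ} (h : (r : EReal) < firstPassage X u ω) :
    stoppedChain X u r ω = X r ω := by
  rw [stoppedChain, stopTime_of_ge h.le]

lemma stoppedChain_of_ge {r : ℝ} (h : firstPassage X u ω ≤ r) :
    stoppedChain X u r ω = X (firstPassage X u ω).toReal ω := by
  rw [stoppedChain, stopTime_of_le h]

lemma stoppedChain_rightContinuous
    (hrc : ∀ t, u ≤ t → ∀ᶠ s in 𝓝[>] t, X s ω = X t ω) {t : ℝ}
    (ht : u ≤ t) :
    ∀ᶠ s in 𝓝[>] t, stoppedChain X u s ω = stoppedChain X u t ω := by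
  rcases lt_or_ge (t : EReal) (firstPassage X u ω) with h | h
  · obtain ⟨b, htb, hb⟩ := EReal.lt_iff_exists_real_btwn.1 h
    filter_upwards [hrc t ht, Ioo_mem_nhdsGT (by exact_mod_cast htb : t < b)] with s hs hsb
    have : (s : EReal) < firstPassage X u ω := lt_trans (by exact_mod_cast hsb.2) hb
    rw [stoppedChain_of_lt h, stoppedChain_of_lt this, hs]
  · filter_upwards [self_mem_nhdsWithin] with s hs
    rw [stoppedChain_of_ge h, stoppedChain_of_ge (h.trans (by exact_mod_cast le_of_lt hs))]

/-! ### Approximation of the stopping time on a grid -/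

/-- A telescoping sum that is switched off once `p` has occurred evaluates the function at the
first index at which `p` holds. -/
lemma exists_sum_until (p : ℕ → Prop) [∀ i, Decidable (∀ l ≤ i, ¬ p l)] (f : ℕ → ℝ) (K : ℕ) :
    ∃ κ ≤ K, (κ = K ∨ p κ) ∧ (∀ l < κ, ¬ p l) ∧
      ∑ i ∈ Finset.range K, (if ∀ l ≤ i, ¬ p l then f (i + 1) - f i else 0) = f κ - f 0 := by
  induction K with
  | zero => exact ⟨0, le_rfl, Or.inl rfl, by simp, by simp⟩
  | succ K ih =>
    obtain ⟨κ, hκ, h1, h2, h3⟩ := ih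
    rw [Finset.sum_range_succ, h3]
    by_cases hp : ∀ l ≤ K, ¬ p l
    · obtain rfl : κ = K := by
        rcases h1 with h1 | h1
        · exact h1
        · exact absurd h1 (hp κ hκ)
      refine ⟨κ + 1, le_rfl, Or.inl rfl, fun l hl => hp l (by omega), ?_⟩
      rw [if_pos hp]
      ring
    · refine ⟨κ, by omega, Or.inr ?_, h2, by rw [if_neg hp, add_zero]⟩
      rcases h1 with rfl | h1
      · by_contra hκp
        refine hp fun l hl => ?_
        rcases hl.eq_or_lt with rfl | hl
        · exact hκp
        · exact h2 l hl
      · exact h1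

/-- The `i`-th point of the partition of `[u, t]` into `n + 1` intervals of equal length. -/
noncomputable def grid (u t : ℝ) (n i : ℕ) : ℝ := u + i * ((t - u) / (n + 1))

lemma grid_zero (u t : ℝ) (n : ℕ) : grid u t n 0 = u := by simp [grid]

lemma grid_last (u t : ℝ) (n : ℕ) : grid u t n (n + 1) = t := by
  have : (n : ℝ) + 1 ≠ 0 := by positivity
  simp only [grid]
  push_cast
  field_simp
  ring

lemma grid_mono {t : ℝ} (hut : u ≤ t) (n : ℕ) : Monotone (grid u t n) := by
  intro i j hij
  have : 0 ≤ (t - u) / (n + 1) := div_nonneg (sub_nonneg.2 hut) (by positivity)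
  simp only [grid]
  gcongr

lemma le_grid {t : ℝ} (hut : u ≤ t) (n i : ℕ) : u ≤ grid u t n i :=
  (grid_zero u t n).ge.trans (grid_mono hut n (Nat.zero_le i))

/-- The system is not empty at the first `i + 1` points of the grid. -/
def aliveOnGrid (X : ℝ → Ω → State k m) (u t : ℝ) (n i : ℕ) : Set Ω :=
  {ω | ∀ l ≤ i, ¬ ∃ a, X (grid u t n l) ω = Sum.inl a}

open Classical in
/-- The increment of `f` from time `u` to the first point of the grid at which the system is
empty, or to time `t` if there is no such point. -/
noncomputable def gridIncrement (X : ℝ → Ω → State k m) (u t : ℝ) (n : ℕ) (f : ℝ → ℝ) (ω : Ω) : ℝ :=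
  ∑ i ∈ Finset.range (n + 1),
    if ω ∈ aliveOnGrid X u t n i then f (grid u t n (i + 1)) - f (grid u t n i) else 0

open Classical in
lemma exists_gridIncrement_eq (X : ℝ → Ω → State k m) (u t : ℝ) (n : ℕ) (f : ℝ → ℝ) (ω : Ω) :
    ∃ κ ≤ n + 1, (κ = n + 1 ∨ ∃ a, X (grid u t n κ) ω = Sum.inl a) ∧
      (∀ l < κ, ¬ ∃ a, X (grid u t n l) ω = Sum.inl a) ∧
      gridIncrement X u t n f ω = f (grid u t n κ) - f u := by
  obtain ⟨κ, h1, h2, h3, h4⟩ := exists_sum_until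
    (fun l => ∃ a, X (grid u t n l) ω = Sum.inl a) (fun i => f (grid u t n i)) (n + 1)
  refine ⟨κ, h1, h2, h3, ?_⟩
  rw [grid_zero] at h4
  rw [← h4]
  exact Finset.sum_congr rfl fun i _ => if_congr Iff.rfl rfl rfl

/-- As the grid is refined, the first grid point with an empty system approaches the capped first
passage time from the right. -/
lemma tendsto_gridIncrement
    (hrc : ∀ t, u ≤ t → ∀ᶠ s in 𝓝[>] t, X s ω = X t ω) {t : ℝ}
    (hut : u ≤ t) {f : ℝ → ℝ}
    (hf : ContinuousWithinAt f (Set.Ici (stopTime X u t ω)) (stopTime X u t ω)) :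
    Tendsto (fun n => gridIncrement X u t n f ω) atTop (𝓝 (f (stopTime X u t ω) - f u)) := by
  choose κ hκ h1 h2 h3 using fun n => exists_gridIncrement_eq X u t n f ω
  simp only [h3]
  refine Tendsto.sub_const ?_ _
  rcases le_or_gt (t : EReal) (firstPassage X u ω) with h | h
  · -- no grid point before `t` has an empty system
    rw [stopTime_of_ge h]
    refine tendsto_const_nhds.congr fun n => ?_
    have ht : grid u t n (κ n) ≤ t := by
      conv_rhs => rw [← grid_last u t n]
      exact grid_mono hut n (hκ n)
    have : grid u t n (κ n) = t := by
      rcases h1 n with he | ⟨a, ha⟩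
      · rw [he, grid_last]
      · refine ht.antisymm (le_of_not_gt fun hlt => ?_)
        exact ne_inl_of_lt_firstPassage hrc (le_grid hut n _)
          (lt_of_lt_of_le (by exact_mod_cast hlt) h) a ha
    rw [this]
  · have hT := coe_toReal_firstPassage h.le
    rw [stopTime_of_le h.le] at hf ⊢
    obtain ⟨a, ha⟩ := exists_eq_inl_firstPassage hrc h.le
    set T := (firstPassage X u ω).toReal
    rw [← hT] at h
    have hTt : T < t := by exact_mod_cast h
    have huT : u ≤ T := by
      have := le_firstPassage (X := X) (u := u) (ω := ω)
      rw [← hT] at this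
      exact_mod_cast this
    have hκT (n : ℕ) : T ≤ grid u t n (κ n) := by
      by_contra hlt
      rw [not_le] at hlt
      rcases h1 n with he | ⟨b, hb⟩
      · rw [he, grid_last] at hlt
        exact absurd hlt hTt.not_gt
      · refine ne_inl_of_lt_firstPassage hrc (le_grid hut n (κ n)) ?_ b hb
        rw [← hT]
        exact_mod_cast hlt
    refine hf.tendsto.comp (tendsto_nhdsWithin_iff.2 ⟨?_, Eventually.of_forall hκT⟩)
    -- on `[T, T + ε)` the system is empty, so the first grid point after `T` is chosen
    obtain ⟨b, hb, hTb⟩ := mem_nhdsGT_iff_exists_Ioo_subset.1 (hrc T huT)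
    have hmesh : Tendsto (fun n : ℕ => (t - u) / ((n : ℝ) + 1)) atTop (𝓝 0) := by
      simpa [div_eq_mul_inv] using
        (tendsto_one_div_add_atTop_nhds_zero_nat (𝕜 := ℝ)).const_mul (t - u)
    have hsq : Tendsto (fun n : ℕ => T + (t - u) / ((n : ℝ) + 1)) atTop (𝓝 T) := by
      simpa using hmesh.const_add T
    refine tendsto_of_tendsto_of_tendsto_of_le_of_le' tendsto_const_nhds hsq
      (Eventually.of_forall hκT) ?_
    filter_upwards [hmesh.eventually (gt_mem_nhds (sub_pos.2 (show T < b from hb)))] with n hn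
    by_contra hlt
    rw [not_le] at hlt
    set δ := (t - u) / ((n : ℝ) + 1) with hδ
    have hδ0 : 0 ≤ δ := div_nonneg (sub_nonneg.2 hut) (by positivity)
    have hex : ∃ l, T ≤ grid u t n l := ⟨κ n, hκT n⟩
    classical
    have hl := Nat.find_spec hex
    set l := Nat.find hex with hldef
    have hlδ : grid u t n l ≤ T + δ := by
      rcases Nat.eq_zero_or_pos l with h0 | h0
      · rw [h0, grid_zero]
        linarith
      · have hpred := Nat.find_min hex (m := l - 1) (by omega)
        rw [not_le] at hpred
        have hstep : grid u t n l = grid u t n (l - 1) + δ := by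
          obtain ⟨l', hl'⟩ := Nat.exists_eq_succ_of_ne_zero h0.ne'
          rw [hl', Nat.succ_sub_one]
          simp only [grid, Nat.succ_eq_add_one, hδ]
          push_cast
          ring
        linarith
    have hlκ : l < κ n := by
      by_contra hle
      exact absurd (grid_mono hut n (not_lt.1 hle)) (by linarith)
    refine h2 n l hlκ ⟨a, ?_⟩
    rcases hl.eq_or_lt with he | hlt'
    · rw [← he, ha]
    · exact (hTb ⟨hlt', by linarith⟩ : _ = _).trans ha

end Paths

/-! ### Measurability of right-continuous processes -/

section Measurability

variable {Ω S : Type*} [MeasurableSpace Ω]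

/-- A process with values in a countable discrete space and right-continuous paths is jointly
measurable, being the limit of its values at the points of `ℤ / (n + 1)` next to the right. Times
before `u`, where nothing is known about the process, are replaced by `u`. -/
lemma measurableSet_rightContinuous {Y : ℝ → Ω → S} {u : ℝ}
    (hm : ∀ t, u ≤ t → ∀ y, MeasurableSet {ω | Y t ω = y})
    (hrc : ∀ ω t, u ≤ t → ∀ᶠ s in 𝓝[>] t, Y s ω = Y t ω) (y : S) :
    MeasurableSet {p : ℝ × Ω | Y (max u p.1) p.2 = y} := by
  set d : ℕ → ℝ → ℝ := fun n r => ((⌊max u r * (n + 1)⌋ : ℤ) + 1 : ℝ) / (n + 1) with hd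
  have hdgt (n : ℕ) (r : ℝ) : max u r < d n r := by
    rw [hd, lt_div_iff₀ (by positivity)]
    exact Int.lt_floor_add_one _
  have hdlim (r : ℝ) : Tendsto (fun n => d n r) atTop (𝓝[>] (max u r)) := by
    refine tendsto_nhdsWithin_iff.2 ⟨?_, Eventually.of_forall fun n => hdgt n r⟩
    have h1 : Tendsto (fun n : ℕ => max u r + 1 / ((n : ℝ) + 1)) atTop (𝓝 (max u r)) := by
      simpa using (tendsto_one_div_add_atTop_nhds_zero_nat (𝕜 := ℝ)).const_add (max u r)
    refine tendsto_of_tendsto_of_tendsto_of_le_of_le tendsto_const_nhds h1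
      (fun n => (hdgt n r).le) fun n => ?_
    have hn : (0 : ℝ) < n + 1 := by positivity
    simp only [hd]
    rw [add_div]
    gcongr
    rw [div_le_iff₀ hn]
    exact Int.floor_le _
  have hset : {p : ℝ × Ω | Y (max u p.1) p.2 = y} =
      ⋃ N : ℕ, ⋂ n : ℕ, ⋂ _ : N ≤ n, {p : ℝ × Ω | Y (d n p.1) p.2 = y} := by
    ext p
    have hev : ∀ᶠ n in atTop, Y (d n p.1) p.2 = Y (max u p.1) p.2 :=
      (hdlim p.1).eventually (hrc p.2 _ (le_max_left _ _))
    simp only [Set.mem_ofPred_eq, Set.mem_iUnion, Set.mem_iInter]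
    rw [← eventually_atTop (p := fun n => Y (d n p.1) p.2 = y)]
    constructor
    · rintro rfl
      exact hev
    · intro h
      obtain ⟨n, h1, h2⟩ := (h.and hev).exists
      exact h2.symm.trans h1
  rw [hset]
  refine MeasurableSet.iUnion fun N => MeasurableSet.iInter fun n =>
    MeasurableSet.iInter fun _ => ?_
  have hunion : {p : ℝ × Ω | Y (d n p.1) p.2 = y} = ⋃ l : ℤ,
      {r : ℝ | ⌊max u r * (n + 1)⌋ = l ∧ u ≤ ((l : ℝ) + 1) / (n + 1)} ×ˢ
        {ω | u ≤ ((l : ℝ) + 1) / (n + 1) ∧ Y (((l : ℝ) + 1) / (n + 1)) ω = y} := by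
    ext p
    have hu : u ≤ d n p.1 := (le_max_left _ _).trans (hdgt n p.1).le
    simp only [Set.mem_ofPred_eq, Set.mem_iUnion, Set.mem_prod]
    constructor
    · intro h
      exact ⟨_, ⟨rfl, hu⟩, hu, h⟩
    · rintro ⟨l, ⟨hl, -⟩, -, h⟩
      simpa only [hd, hl] using h
  rw [hunion]
  refine MeasurableSet.iUnion fun l => MeasurableSet.prod ?_ ?_
  · refine MeasurableSet.inter ?_ (MeasurableSet.const _)
    have : Measurable fun r : ℝ => ⌊max u r * (n + 1)⌋ := by fun_prop
    exact this (MeasurableSet.singleton l)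
  · by_cases hl : u ≤ ((l : ℝ) + 1) / (n + 1)
    · simpa only [hl, true_and] using hm _ hl y
    · simp [hl]

lemma measurable_comp_rightContinuous [Countable S] {Y : ℝ → Ω → S} {u : ℝ}
    (hm : ∀ t, u ≤ t → ∀ y, MeasurableSet {ω | Y t ω = y})
    (hrc : ∀ ω t, u ≤ t → ∀ᶠ s in 𝓝[>] t, Y s ω = Y t ω) (g : S → ℝ) :
    Measurable fun p : ℝ × Ω => g (Y (max u p.1) p.2) := by
  let _ : MeasurableSpace S := ⊤
  have h : Measurable fun p : ℝ × Ω => Y (max u p.1) p.2 :=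
    measurable_to_countable' fun y => measurableSet_rightContinuous hm hrc y
  exact (measurable_from_top (f := g)).comp h

end Measurability

/-! ### The generator -/

section Generator

variable {k m : ℕ}

/-- The entries of the generator are linear in the two rates. -/
lemma generator_eq (lam mu : ℝ → ℝ) (t : ℝ) (x y : State k m) :
    generator lam mu t x y = generator (fun _ => 1) (fun _ => 0) 0 x y * lam t +
      generator (fun _ => 0) (fun _ => 1) 0 x y * mu t := by
  rcases x with a | ⟨n, p⟩ <;> rcases y with b | ⟨n', p'⟩
  · simp only [generator, phaseMatrix, Matrix.of_apply]
    split_ifs <;> simp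
  · simp only [generator, Qzeroone, Matrix.of_apply]
    split_ifs <;> simp
  · simp only [generator, Qonezero, Matrix.of_apply]
    split_ifs <;> simp
  · obtain ⟨p₁, p₂⟩ := p
    obtain ⟨p₁', p₂'⟩ := p'
    simp only [generator, Apos, Azero, Aneg, Matrix.add_apply, Matrix.kronecker_apply, phaseMatrix,
      completionMatrix, Matrix.of_apply, Matrix.one_apply]
    split_ifs <;> simp

lemma abs_generator_le (lam mu : ℝ → ℝ) (t : ℝ) (x y : State k m) :
    |generator lam mu t x y| ≤ |lam t| + |mu t| := by
  have h1 := abs_nonneg (lam t)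
  have h2 := abs_nonneg (mu t)
  have h3 := abs_add_le (-lam t) (-mu t)
  rw [abs_neg, abs_neg] at h3
  rcases x with a | ⟨n, p⟩ <;> rcases y with b | ⟨n', p'⟩
  · simp only [generator, phaseMatrix, Matrix.of_apply]
    split_ifs <;> (try simp only [abs_neg, abs_zero]) <;> linarith
  · simp only [generator, Qzeroone, Matrix.of_apply]
    split_ifs <;> (try simp only [abs_zero]) <;> linarith
  · simp only [generator, Qonezero, Matrix.of_apply]
    split_ifs <;> (try simp only [abs_zero]) <;> linarith
  · obtain ⟨p₁, p₂⟩ := p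
    obtain ⟨p₁', p₂'⟩ := p'
    simp only [generator, Apos, Azero, Aneg, Matrix.add_apply, Matrix.kronecker_apply, phaseMatrix,
      completionMatrix, Matrix.of_apply, Matrix.one_apply]
    split_ifs <;> (try simp only [mul_one, mul_zero, zero_mul, one_mul, add_zero, zero_add,
      abs_zero]) <;> linarith

/-- The generator of the chain stopped at the first passage to the empty system. -/
def stoppedGenerator (lam mu : ℝ → ℝ) (t : ℝ) : State k m → State k m → ℝ
  | Sum.inl _, _ => 0
  | Sum.inr x, y => generator lam mu t (Sum.inr x) y

lemma stoppedGenerator_eq (lam mu : ℝ → ℝ) (t : ℝ) (x y : State k m) :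
    stoppedGenerator lam mu t x y = stoppedGenerator (fun _ => 1) (fun _ => 0) 0 x y * lam t +
      stoppedGenerator (fun _ => 0) (fun _ => 1) 0 x y * mu t := by
  rcases x with a | x
  · simp [stoppedGenerator]
  · exact generator_eq lam mu t _ y

lemma abs_stoppedGenerator_le (lam mu : ℝ → ℝ) (t : ℝ) (x y : State k m) :
    |stoppedGenerator lam mu t x y| ≤ |lam t| + |mu t| := by
  rcases x with a | x
  · simp only [stoppedGenerator, abs_zero]
    positivity
  · exact abs_generator_le lam mu t _ y

lemma exists_abs_rates_le {lam mu : ℝ → ℝ} (hlam : Continuous lam) (hmu : Continuous mu)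
    (u t : ℝ) : ∃ C, 0 ≤ C ∧ ∀ r ∈ Set.Icc u t, |lam r| + |mu r| ≤ C := by
  obtain ⟨C, hC⟩ := (isCompact_Icc (a := u) (b := t)).exists_bound_of_continuousOn
    (f := fun r => |lam r| + |mu r|) (by fun_prop)
  refine ⟨max C 0, le_max_right _ _, fun r hr => ?_⟩
  exact (le_abs_self _).trans ((hC r hr).trans (le_max_left _ _))

end Generator

/-! ### Consequences of the martingale property -/

section Martingale

variable {Ω S : Type*} {u : ℝ} {X : ℝ → Ω → S}

lemma measurableSet_past {r s : ℝ} (hr : r ∈ Set.Icc u s) (D : Set S) :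
    MeasurableSet[past X u s] {ω | X r ω ∈ D} :=
  le_iSup₂ (f := fun r (_ : r ∈ Set.Icc u s) => MeasurableSpace.comap (X r) ⊤) r hr _
    ⟨D, trivial, rfl⟩

lemma compensated_eq (G : ℝ → S → S → ℝ) (X : ℝ → Ω → S) (u : ℝ) (y : S) (t : ℝ) (ω : Ω) :
    compensated G X u y t ω =
      {ω | X t ω = y}.indicator 1 ω - ∫ r in u..t, G r (X r ω) y := by
  by_cases h : X t ω = y <;> simp [compensated, h]

variable [mΩ : MeasurableSpace Ω] {P : Measure Ω} {G : ℝ → S → S → ℝ}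

lemma IsMarkovChain.past_le [Countable S] (hX : IsMarkovChain P G u X) (s : ℝ) :
    past X u s ≤ mΩ := by
  refine iSup₂_le fun r hr => ?_
  rintro _ ⟨D, -, rfl⟩
  have : X r ⁻¹' D = ⋃ y ∈ D, {ω | X r ω = y} := by
    ext ω
    simp
  rw [this]
  exact MeasurableSet.biUnion D.to_countable fun y _ => hX.measurable r hr.1 y

/-- Integrability is part of the martingale property: the compensated process agrees almost
everywhere with a conditional expectation. -/
lemma IsMarkovChain.integrable_compensated (hX : IsMarkovChain P G u X) (y : S) {t : ℝ}
    (hut : u ≤ t) : Integrable (compensated G X u y t) P :=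
  integrable_condExp.congr (hX.martingale y t t hut le_rfl)

lemma IsMarkovChain.setIntegral_compensated [IsFiniteMeasure P] [Countable S]
    (hX : IsMarkovChain P G u X) (y : S) {s t : ℝ} (hus : u ≤ s) (hst : s ≤ t) {A : Set Ω}
    (hA : MeasurableSet[past X u s] A) :
    ∫ ω in A, compensated G X u y t ω ∂P = ∫ ω in A, compensated G X u y s ω ∂P := by
  rw [← setIntegral_condExp (hX.past_le s) (hX.integrable_compensated y (hus.trans hst)) hA]
  exact integral_congr_ae (ae_restrict_of_ae (hX.martingale y s t hus hst))

end Martingale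

section Stopping

variable {k m : ℕ} {lam mu : ℝ → ℝ} {Ω : Type*} {u : ℝ} {X : ℝ → Ω → State k m}

lemma measurableSet_aliveOnGrid {t : ℝ} (hut : u ≤ t) (n i : ℕ) :
    MeasurableSet[past X u (grid u t n i)] (aliveOnGrid X u t n i) := by
  have : aliveOnGrid X u t n i =
      ⋂ l : ℕ, ⋂ _ : l ≤ i, {ω | X (grid u t n l) ω ∈ {x | ¬ ∃ a, x = Sum.inl a}} := by
    ext ω
    simp [aliveOnGrid]
  rw [this]
  exact MeasurableSet.iInter fun l => MeasurableSet.iInter fun hl =>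
    measurableSet_past ⟨le_grid hut n l, grid_mono hut n hl⟩ _

open Classical in
lemma gridIncrement_eq_indicator (t : ℝ) (n : ℕ) (f : ℝ → Ω → ℝ) (ω : Ω) :
    gridIncrement X u t n (fun s => f s ω) ω = ∑ i ∈ Finset.range (n + 1),
      (aliveOnGrid X u t n i).indicator
        (fun ω => f (grid u t n (i + 1)) ω - f (grid u t n i) ω) ω := by
  simp only [gridIncrement, Set.indicator_apply]

lemma abs_compensated_le {C t : ℝ} (hC0 : 0 ≤ C)
    (hC : ∀ r ∈ Set.Icc u t, |lam r| + |mu r| ≤ C) (y : State k m) (ω : Ω) {s : ℝ}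
    (hs : s ∈ Set.Icc u t) :
    |compensated (generator lam mu) X u y s ω| ≤ 1 + C * (t - u) := by
  have h1 : |∫ r in u..s, generator lam mu r (X r ω) y| ≤ C * |s - u| := by
    rw [← Real.norm_eq_abs]
    refine intervalIntegral.norm_integral_le_of_norm_le_const fun r hr => ?_
    rw [Set.uIoc_of_le hs.1] at hr
    exact (abs_generator_le lam mu r _ y).trans (hC r ⟨hr.1.le, hr.2.trans hs.2⟩)
  have h2 : |{ω | X s ω = y}.indicator (1 : Ω → ℝ) ω| ≤ 1 := by
    rw [Set.indicator_apply]
    split_ifs <;> simp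
  have h3 : C * |s - u| ≤ C * (t - u) := by
    rw [abs_of_nonneg (sub_nonneg.2 hs.1)]
    gcongr
    exact hs.2
  rw [compensated_eq]
  exact (abs_sub _ _).trans (add_le_add h2 (h1.trans h3))

variable [MeasurableSpace Ω] {P : Measure Ω}

open Classical in
/-- The events `{X_{τ ∧ t} = y}` are measurable. -/
lemma measurableSet_stoppedChain (hX : IsMarkovChain P (generator lam mu) u X)
    {t : ℝ} (hut : u ≤ t) (y : State k m) :
    MeasurableSet {ω | stoppedChain X u t ω = y} := by
  set f : ℝ → Ω → ℝ := fun s ω => if X s ω = y then 1 else 0 with hf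
  have hfm (s : ℝ) (hs : u ≤ s) : Measurable (f s) :=
    Measurable.ite (hX.measurable s hs y) measurable_const measurable_const
  have hlim (ω : Ω) : Tendsto (fun n => gridIncrement X u t n (fun s => f s ω) ω) atTop
      (𝓝 (f (stopTime X u t ω) ω - f u ω)) := by
    refine tendsto_gridIncrement (f := fun s => f s ω) (hX.right_continuous ω) hut ?_
    rw [← continuousWithinAt_Ioi_iff_Ici]
    refine tendsto_const_nhds.congr' ?_
    filter_upwards [hX.right_continuous ω _ (le_stopTime hut)] with s hs
    simp only [hf, hs]
  have hmeas : Measurable fun ω => f (stopTime X u t ω) ω - f u ω := by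
    refine measurable_of_tendsto_metrizable (fun n => ?_) (tendsto_pi_nhds.2 hlim)
    simp only [gridIncrement_eq_indicator]
    refine Finset.measurable_sum _ fun i _ => Measurable.indicator ?_
      (hX.past_le _ _ (measurableSet_aliveOnGrid hut n i))
    exact (hfm _ (le_grid hut n _)).sub (hfm _ (le_grid hut n _))
  have hmeas' : Measurable fun ω => f (stopTime X u t ω) ω := by
    convert! hmeas.add (hfm u le_rfl) using 1
    ext ω
    simp
  convert! hmeas' (MeasurableSet.singleton (1 : ℝ)) using 1
  ext ω
  simp [hf, stoppedChain]

lemma measurable_generator_chain (hX : IsMarkovChain P (generator lam mu) u X)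
    (hlam : Continuous lam) (hmu : Continuous mu) (y : State k m) :
    Measurable fun p : ℝ × Ω => generator lam mu p.1 (X (max u p.1) p.2) y := by
  simp only [generator_eq lam mu]
  have h (g : State k m → ℝ) := measurable_comp_rightContinuous hX.measurable hX.right_continuous g
  exact ((h fun x => generator (fun _ => 1) (fun _ => 0) 0 x y).mul
    (hlam.measurable.comp measurable_fst)).add
    ((h fun x => generator (fun _ => 0) (fun _ => 1) 0 x y).mul
      (hmu.measurable.comp measurable_fst))

lemma measurable_comp_stoppedChain (hX : IsMarkovChain P (generator lam mu) u X)
    (g : State k m → ℝ) :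
    Measurable fun p : ℝ × Ω => g (stoppedChain X u (max u p.1) p.2) :=
  measurable_comp_rightContinuous (fun _ ht y => measurableSet_stoppedChain hX ht y)
    (fun ω _ ht => stoppedChain_rightContinuous (hX.right_continuous ω) ht) g

lemma measurable_generator_stoppedChain (hX : IsMarkovChain P (generator lam mu) u X)
    (hlam : Continuous lam) (hmu : Continuous mu)
    (y : State k m) : Measurable fun p : ℝ × Ω =>
      stoppedGenerator lam mu p.1 (stoppedChain X u (max u p.1) p.2) y := by
  simp only [stoppedGenerator_eq lam mu]
  have h := measurable_comp_stoppedChain hX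
  exact ((h fun x => stoppedGenerator (fun _ => 1) (fun _ => 0) 0 x y).mul
    (hlam.measurable.comp measurable_fst)).add
    ((h fun x => stoppedGenerator (fun _ => 0) (fun _ => 1) 0 x y).mul
      (hmu.measurable.comp measurable_fst))

lemma intervalIntegrable_generator_chain (hX : IsMarkovChain P (generator lam mu) u X)
    (hlam : Continuous lam) (hmu : Continuous mu)
    (y : State k m) (ω : Ω) (a b : ℝ) :
    IntervalIntegrable (fun r => generator lam mu r (X (max u r) ω) y) volume a b := by
  refine ((by fun_prop : Continuous fun r => |lam r| + |mu r|).intervalIntegrable a b).mono_fun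
    ((measurable_generator_chain hX hlam hmu y).comp
      measurable_prodMk_right).aestronglyMeasurable (ae_of_all _ fun r => ?_)
  exact (abs_generator_le lam mu r _ y).trans (le_abs_self _)

lemma intervalIntegrable_generator_stoppedChain (hX : IsMarkovChain P (generator lam mu) u X)
    (hlam : Continuous lam) (hmu : Continuous mu)
    (y : State k m) (ω : Ω) (a b : ℝ) :
    IntervalIntegrable (fun r => stoppedGenerator lam mu r (stoppedChain X u (max u r) ω) y)
      volume a b := by
  refine ((by fun_prop : Continuous fun r => |lam r| + |mu r|).intervalIntegrable a b).mono_fun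
    ((measurable_generator_stoppedChain hX hlam hmu y).comp
      measurable_prodMk_right).aestronglyMeasurable (ae_of_all _ fun r => ?_)
  exact (abs_stoppedGenerator_le lam mu r _ y).trans (le_abs_self _)

/-- The compensator up to the capped first passage time is the compensator of the stopped chain. -/
lemma integral_stopTime_eq (hX : IsMarkovChain P (generator lam mu) u X)
    (hlam : Continuous lam) (hmu : Continuous mu) {t : ℝ} (hut : u ≤ t)
    (y : State k m) (ω : Ω) :
    ∫ r in u..stopTime X u t ω, generator lam mu r (X r ω) y =
      ∫ r in u..t, stoppedGenerator lam mu r (stoppedChain X u (max u r) ω) y := by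
  have hσt := stopTime_le X u t ω
  have huσ := le_stopTime (X := X) (ω := ω) hut
  have hfp := coe_stopTime X u t ω
  rw [← intervalIntegral.integral_add_adjacent_intervals
    (intervalIntegrable_generator_stoppedChain hX hlam hmu y ω u (stopTime X u t ω))
    (intervalIntegrable_generator_stoppedChain hX hlam hmu y ω (stopTime X u t ω) t)]
  have h2 : ∫ r in stopTime X u t ω..t,
      stoppedGenerator lam mu r (stoppedChain X u (max u r) ω) y = 0 := by
    refine (intervalIntegral.integral_congr_Ioo_of_le hσt (g := fun _ => 0)
      fun r hr => ?_).trans (by simp)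
    have hr' : firstPassage X u ω ≤ r := by
      have : (stopTime X u t ω : EReal) < r := by exact_mod_cast hr.1
      rw [hfp, min_lt_iff] at this
      rcases this with h | h
      · exact h.le
      · exact absurd hr.2 (by exact_mod_cast h.not_gt)
    obtain ⟨a, ha⟩ := exists_eq_inl_firstPassage (hX.right_continuous ω) hr'
    simp only [max_eq_right (huσ.trans hr.1.le), stoppedChain_of_ge hr', ha, stoppedGenerator]
  rw [h2, add_zero]
  refine intervalIntegral.integral_congr_Ioo_of_le huσ fun r hr => ?_
  have hr' : (r : EReal) < firstPassage X u ω := by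
    have : (r : EReal) < stopTime X u t ω := by exact_mod_cast hr.2
    rw [hfp] at this
    exact this.trans_le (min_le_left _ _)
  have hne := ne_inl_of_lt_firstPassage (hX.right_continuous ω) hr.1.le hr'
  simp only [max_eq_right hr.1.le, stoppedChain_of_lt hr']
  rcases h : X r ω with a | x
  · exact absurd h (hne a)
  · rfl

lemma compensated_continuousWithinAt (hX : IsMarkovChain P (generator lam mu) u X)
    (hlam : Continuous lam) (hmu : Continuous mu)
    (y : State k m) (ω : Ω) {σ : ℝ} (hσ : u ≤ σ) :
    ContinuousWithinAt (fun s => compensated (generator lam mu) X u y s ω) (Set.Ici σ) σ := by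
  have hint : Continuous fun s => ∫ r in u..s, generator lam mu r (X (max u r) ω) y :=
    intervalIntegral.continuous_primitive
      (fun a b => intervalIntegrable_generator_chain hX hlam hmu y ω a b) u
  have hind : ContinuousWithinAt (fun s => {ω | X s ω = y}.indicator (1 : Ω → ℝ) ω)
      (Set.Ici σ) σ := by
    rw [← continuousWithinAt_Ioi_iff_Ici]
    refine tendsto_const_nhds.congr' ?_
    filter_upwards [hX.right_continuous ω _ hσ] with s hs
    simp only [Set.indicator_apply, Set.mem_ofPred_eq, hs]
  have heq (s : ℝ) (hs : u ≤ s) : ∫ r in u..s, generator lam mu r (X r ω) y =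
      ∫ r in u..s, generator lam mu r (X (max u r) ω) y := by
    refine intervalIntegral.integral_congr fun r hr => ?_
    rw [Set.uIcc_of_le hs] at hr
    simp only [max_eq_right hr.1]
  refine (hind.sub hint.continuousWithinAt).congr (fun s hs => ?_) ?_
  · rw [compensated_eq, heq s (hσ.trans hs)]
    rfl
  · rw [compensated_eq, heq σ hσ]
    rfl

variable [IsProbabilityMeasure P]

/-- Optional sampling on a grid. -/
lemma setIntegral_gridIncrement (hX : IsMarkovChain P (generator lam mu) u X)
    {t : ℝ} (hut : u ≤ t) (n : ℕ) (y : State k m) {B : Set Ω}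
    (hB : MeasurableSet[past X u u] B) :
    ∫ ω in B, gridIncrement X u t n
      (fun s => compensated (generator lam mu) X u y s ω) ω ∂P = 0 := by
  have hi (i : ℕ) := hX.integrable_compensated y (le_grid hut n i)
  have hm (i : ℕ) := measurableSet_aliveOnGrid (X := X) hut n i
  simp only [gridIncrement_eq_indicator]
  have hs (i : ℕ) : Integrable (fun ω => compensated (generator lam mu) X u y
      (grid u t n (i + 1)) ω - compensated (generator lam mu) X u y (grid u t n i) ω) P :=
    (hi (i + 1)).sub (hi i)
  rw [integral_finsetSum _ fun i _ => ((hs i).indicator (hX.past_le _ _ (hm i))).integrableOn]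
  refine Finset.sum_eq_zero fun i _ => ?_
  rw [setIntegral_indicator (hX.past_le _ _ (hm i)),
    integral_sub (hi (i + 1)).integrableOn (hi i).integrableOn, sub_eq_zero]
  refine hX.setIntegral_compensated y (le_grid hut n i) (grid_mono hut n (Nat.le_succ i))
    (MeasurableSet.inter ?_ (hm i))
  have hle : past X u u ≤ past X u (grid u t n i) :=
    iSup₂_le fun r hr => le_iSup₂
      (f := fun r (_ : r ∈ Set.Icc u (grid u t n i)) => MeasurableSpace.comap (X r) ⊤) r
      ⟨hr.1, hr.2.trans (le_grid hut n i)⟩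
  exact hle _ hB

/-- Optional sampling at the capped first passage time. -/
lemma setIntegral_compensated_stopTime (hX : IsMarkovChain P (generator lam mu) u X)
    (hlam : Continuous lam) (hmu : Continuous mu) {t : ℝ}
    (hut : u ≤ t) (y : State k m) {B : Set Ω} (hB : MeasurableSet[past X u u] B) :
    ∫ ω in B, (compensated (generator lam mu) X u y (stopTime X u t ω) ω -
      compensated (generator lam mu) X u y u ω) ∂P = 0 := by
  obtain ⟨C, hC0, hC⟩ := exists_abs_rates_le hlam hmu u t
  refine tendsto_nhds_unique (f := fun n : ℕ => ∫ ω in B, gridIncrement X u t n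
      (fun s => compensated (generator lam mu) X u y s ω) ω ∂P) (l := atTop) ?_
    (by simp only [setIntegral_gridIncrement hX hut _ y hB]; exact tendsto_const_nhds)
  refine tendsto_integral_of_dominated_convergence
    (fun _ => (1 + C * (t - u)) + (1 + C * (t - u))) (fun n => ?_) (integrable_const _)
    (fun n => ae_of_all _ fun ω => ?_) (ae_of_all _ fun ω => ?_)
  · simp only [gridIncrement_eq_indicator]
    refine Finset.aestronglyMeasurable_fun_sum _ fun i _ => ?_
    have hi (i : ℕ) := (hX.integrable_compensated y (le_grid hut n i)).aestronglyMeasurable.restrict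
      (s := B)
    exact ((hi (i + 1)).sub (hi i)).indicator (hX.past_le _ _ (measurableSet_aliveOnGrid hut n i))
  · obtain ⟨κ, hκ, -, -, h⟩ := exists_gridIncrement_eq X u t n
      (fun s => compensated (generator lam mu) X u y s ω) ω
    rw [h]
    have ht : grid u t n κ ≤ t := (grid_mono hut n hκ).trans_eq (grid_last u t n)
    exact (norm_sub_le _ _).trans (add_le_add
      (abs_compensated_le hC0 hC y ω ⟨le_grid hut n κ, ht⟩)
      (abs_compensated_le hC0 hC y ω ⟨le_rfl, hut⟩))
  · exact tendsto_gridIncrement (hX.right_continuous ω) hut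
      (compensated_continuousWithinAt hX hlam hmu y ω (le_stopTime hut))

/-- Kolmogorov's forward equation, in integrated form, for the chain stopped at the first passage
to the empty system. -/
theorem stopped_forward_equation (hX : IsMarkovChain P (generator lam mu) u X)
    (hlam : Continuous lam) (hmu : Continuous mu) {t : ℝ}
    (hut : u ≤ t) (y : State k m) {B : Set Ω} (hB : MeasurableSet[past X u u] B) :
    (ProbabilityTheory.cond P B).real {ω | stoppedChain X u t ω = y} =
      (ProbabilityTheory.cond P B).real {ω | X u ω = y} +
        ∫ r in u..t, ∫ ω, stoppedGenerator lam mu r (stoppedChain X u (max u r) ω) y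
          ∂(ProbabilityTheory.cond P B) := by
  set μ := ProbabilityTheory.cond P B with hμ
  have h0 : ∫ ω, (compensated (generator lam mu) X u y (stopTime X u t ω) ω -
      compensated (generator lam mu) X u y u ω) ∂μ = 0 := by
    rw [hμ, ProbabilityTheory.cond, integral_smul_measure,
      setIntegral_compensated_stopTime hX hlam hmu hut y hB, smul_zero]
  obtain ⟨C, hC0, hC⟩ := exists_abs_rates_le hlam hmu u t
  have hjoint : Integrable (fun p : ℝ × Ω =>
      stoppedGenerator lam mu p.1 (stoppedChain X u (max u p.1) p.2) y)
      ((volume.restrict (Set.uIoc u t)).prod μ) := by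
    have hb : Integrable (fun _ : ℝ × Ω => C) ((volume.restrict (Set.uIoc u t)).prod μ) := by
      rw [Set.uIoc_of_le hut]
      exact integrable_const _
    refine hb.mono' (measurable_generator_stoppedChain hX hlam hmu y).aestronglyMeasurable ?_
    have hae : ∀ᵐ r ∂(volume.restrict (Set.uIoc u t)), |lam r| + |mu r| ≤ C := by
      refine (ae_restrict_iff' measurableSet_uIoc).2 (ae_of_all _ fun r hr => ?_)
      rw [Set.uIoc_of_le hut] at hr
      exact hC r (Set.Ioc_subset_Icc_self hr)
    filter_upwards [Measure.quasiMeasurePreserving_fst.ae hae] with p hp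
    exact (abs_stoppedGenerator_le lam mu p.1 _ y).trans hp
  have hind (E : Set Ω) (hE : MeasurableSet E) : Integrable (E.indicator (1 : Ω → ℝ)) μ ∧
      ∫ ω, E.indicator (1 : Ω → ℝ) ω ∂μ = μ.real E :=
    ⟨(integrable_const _).indicator hE, integral_indicator_one hE⟩
  obtain ⟨hi1, he1⟩ := hind _ (measurableSet_stoppedChain hX hut y)
  obtain ⟨hi2, he2⟩ := hind _ (hX.measurable u le_rfl y)
  have hi3 : Integrable (fun ω => ∫ r in u..t,
      stoppedGenerator lam mu r (stoppedChain X u (max u r) ω) y) μ := by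
    simp only [intervalIntegral.integral_of_le hut]
    rw [Set.uIoc_of_le hut] at hjoint
    exact hjoint.integral_prod_right
  have h1 (ω : Ω) : compensated (generator lam mu) X u y (stopTime X u t ω) ω -
      compensated (generator lam mu) X u y u ω =
      {ω | stoppedChain X u t ω = y}.indicator (1 : Ω → ℝ) ω -
        (∫ r in u..t, stoppedGenerator lam mu r (stoppedChain X u (max u r) ω) y) -
        {ω | X u ω = y}.indicator (1 : Ω → ℝ) ω := by
    simp only [compensated_eq, integral_stopTime_eq hX hlam hmu hut y ω,
      intervalIntegral.integral_same, sub_zero]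
    rfl
  simp only [h1] at h0
  have hi4 := hi1.sub hi3
  simp only [Pi.sub_def] at hi4
  rw [integral_sub hi4 hi2, integral_sub hi1 hi3, he1, he2] at h0
  rw [intervalIntegral_integral_swap hjoint]
  linarith

end Stopping

/-! ### Forward equations by level -/

section Levels

variable {k m : ℕ}

/-- The indicator function of `n` customers and phase pair `p`; the state `Sum.inl a` of the empty
system carries the phase pair `(a, 0)`. -/
def levelIndicator (n : ℕ) (p : Phase k m) : State k m → ℝ
  | Sum.inl a => if n = 0 ∧ p.1 = a ∧ p.2.val = 0 then 1 else 0
  | Sum.inr (l, p') => if (l : ℕ) = n ∧ p' = p then 1 else 0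

/-- The rate at which the stopped chain passes from the state `x` to level `n` and phases `i`, in
terms of the blocks `A₁`, `A₀`, `A₋₁`. Level `0` is absorbing, whence no transition starts there.
For `n = 0` the truncated difference `n - 1 = 0` makes the first term vanish as it should. -/
noncomputable def levelGenerator (lam mu : ℝ → ℝ) (n : ℕ) (i : Phase k m) (r : ℝ)
    (x : State k m) : ℝ :=
  ∑ p, ((if n - 1 = 0 then 0 else levelIndicator (n - 1) p x) * Apos lam r p i +
    (if n = 0 then 0 else levelIndicator n p x) * Azero lam mu r p i +
    levelIndicator (n + 1) p x * Aneg mu r p i)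

lemma sum_levelIndicator_inr (n : ℕ) (l : ℕ+) (p' : Phase k m) (f : Phase k m → ℝ) :
    ∑ p, levelIndicator n p (Sum.inr (l, p')) * f p = if (l : ℕ) = n then f p' else 0 := by
  by_cases h : (l : ℕ) = n <;> simp [levelIndicator, h]

lemma levelGenerator_inl (lam mu : ℝ → ℝ) (n : ℕ) (i : Phase k m) (r : ℝ) (a : Fin k) :
    levelGenerator lam mu n i r (Sum.inl a) = 0 := by
  refine Finset.sum_eq_zero fun p _ => ?_
  have h (l : ℕ) : (if l = 0 then 0 else levelIndicator l p (Sum.inl a)) = 0 := by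
    by_cases hl : l = 0 <;> simp [levelIndicator, hl]
  rw [h, h]
  simp [levelIndicator]

lemma levelGenerator_inr (lam mu : ℝ → ℝ) (n : ℕ) (i : Phase k m) (r : ℝ) (l : ℕ+)
    (p' : Phase k m) :
    levelGenerator lam mu n i r (Sum.inr (l, p')) =
      (if (l : ℕ) = n - 1 then Apos lam r p' i else 0) +
        (if (l : ℕ) = n then Azero lam mu r p' i else 0) +
        (if (l : ℕ) = n + 1 then Aneg mu r p' i else 0) := by
  have h (n : ℕ) (p : Phase k m) : (if n = 0 then 0 else levelIndicator n p (Sum.inr (l, p'))) =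
      levelIndicator n p (Sum.inr (l, p')) := by
    have := l.pos
    by_cases hn : n = 0
    · simp [levelIndicator, hn]
    · simp [hn]
  simp only [levelGenerator, h, Finset.sum_add_distrib, sum_levelIndicator_inr]

lemma stoppedGenerator_eq_levelGenerator (lam mu : ℝ → ℝ) (r : ℝ) (x : State k m) (n : ℕ+)
    (i : Phase k m) :
    stoppedGenerator lam mu r x (Sum.inr (n, i)) = levelGenerator lam mu n i r x := by
  rcases x with a | ⟨l, p'⟩
  · rw [levelGenerator_inl]
    rfl
  · have hl := l.pos
    have hn := n.pos
    simp only [levelGenerator_inr, stoppedGenerator, generator, ← PNat.coe_inj, PNat.add_coe,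
      PNat.one_coe]
    split_ifs <;> first | omega | simp

lemma stoppedGenerator_eq_levelGenerator_zero (lam mu : ℝ → ℝ) (r : ℝ) (x : State k m)
    (i : Phase k m) (hi : i.2.val = 0) :
    stoppedGenerator lam mu r x (Sum.inl i.1) = levelGenerator lam mu 0 i r x := by
  rcases x with a | ⟨l, p'⟩
  · rw [levelGenerator_inl]
    rfl
  · have hl := l.pos
    obtain ⟨i₁, i₂⟩ := i
    obtain ⟨p₁, p₂⟩ := p'
    have hi : i₂.val = 0 := hi
    simp only [levelGenerator_inr, stoppedGenerator, generator, ← PNat.coe_inj, PNat.one_coe,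
      hl.ne', Nat.zero_sub, if_false, zero_add, Qonezero, Aneg, Matrix.kronecker_apply,
      completionMatrix, Matrix.of_apply, Matrix.one_apply, hi, ite_and]
    split_ifs <;> simp

/-- The empty system is entered in the first service phase only. -/
lemma levelGenerator_zero_of_ne (lam mu : ℝ → ℝ) (r : ℝ) (x : State k m)
    (i : Phase k m) (hi : i.2.val ≠ 0) : levelGenerator lam mu 0 i r x = 0 := by
  rcases x with a | ⟨l, p'⟩
  · exact levelGenerator_inl ..
  · have hl := l.pos
    obtain ⟨i₁, i₂⟩ := i
    obtain ⟨p₁, p₂⟩ := p'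
    have hi : i₂.val ≠ 0 := hi
    simp [levelGenerator_inr, hl.ne', Aneg, completionMatrix, hi]

lemma levelIndicator_pos (n : ℕ+) (i : Phase k m) :
    levelIndicator n i = {x | x = Sum.inr (n, i)}.indicator 1 := by
  funext x
  rcases x with a | ⟨l, p⟩
  · simp [levelIndicator]
  · simp [levelIndicator, Set.indicator_apply]

lemma levelIndicator_zero (i : Phase k m) (hi : i.2.val = 0) :
    levelIndicator 0 i = {x | x = Sum.inl i.1}.indicator 1 := by
  funext x
  rcases x with a | ⟨l, p⟩
  · simp [levelIndicator, Set.indicator_apply, hi, eq_comm]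
  · simp [levelIndicator]

lemma levelIndicator_zero_of_ne (i : Phase k m) (hi : i.2.val ≠ 0) :
    levelIndicator 0 i = fun _ => 0 := by
  funext x
  rcases x with a | ⟨l, p⟩ <;> simp [levelIndicator, hi]

lemma abs_levelIndicator_le (n : ℕ) (i : Phase k m) (x : State k m) :
    |levelIndicator n i x| ≤ 1 := by
  rcases x with a | ⟨l, p⟩ <;> simp only [levelIndicator] <;> split_ifs <;> simp

end Levels

section LevelVector

variable {k m : ℕ} {lam mu : ℝ → ℝ} {Ω : Type*} {u : ℝ} {X : ℝ → Ω → State k m} {j : ℕ+}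
  {q : Phase k m}

lemma stoppedChain_eq_inl_iff (hrc : ∀ ω t, u ≤ t → ∀ᶠ s in 𝓝[>] t, X s ω = X t ω) {t : ℝ}
    (hut : u ≤ t) (a : Fin k) (ω : Ω) :
    stoppedChain X u t ω = Sum.inl a ↔
      firstPassage X u ω ≤ t ∧ X (firstPassage X u ω).toReal ω = Sum.inl a := by
  rcases lt_or_ge (t : EReal) (firstPassage X u ω) with h | h
  · rw [stoppedChain_of_lt h]
    exact ⟨fun ha => absurd ha (ne_inl_of_lt_firstPassage (hrc ω) hut h a),
      fun ha => absurd h ha.1.not_gt⟩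
  · rw [stoppedChain_of_ge h]
    exact ⟨fun ha => ⟨h, ha⟩, fun ha => ha.2⟩

/-- A first passage before `t` is one up to some `t - 1 / (n + 1)`; this describes the event by the
stopped chain at countably many times. -/
lemma passage_eq_iUnion (hrc : ∀ ω t, u ≤ t → ∀ᶠ s in 𝓝[>] t, X s ω = X t ω) (t : ℝ)
    (a : Fin k) :
    {ω | firstPassage X u ω < (t : EReal) ∧ X (firstPassage X u ω).toReal ω = Sum.inl a} =
      ⋃ n : ℕ, ⋃ _ : u ≤ t - 1 / ((n : ℝ) + 1),
        {ω | stoppedChain X u (t - 1 / ((n : ℝ) + 1)) ω = Sum.inl a} := by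
  ext ω
  simp only [Set.mem_ofPred_eq, Set.mem_iUnion, exists_prop]
  constructor
  · rintro ⟨h, ha⟩
    have hT := coe_toReal_firstPassage h.le
    have hTt : (firstPassage X u ω).toReal < t := by
      rw [← hT] at h
      exact_mod_cast h
    obtain ⟨n, hn⟩ := exists_nat_one_div_lt (sub_pos.2 hTt)
    have hle : firstPassage X u ω ≤ ((t - 1 / ((n : ℝ) + 1) : ℝ) : EReal) := by
      rw [← hT]
      exact EReal.coe_le_coe_iff.2 (by linarith)
    have hu : u ≤ t - 1 / ((n : ℝ) + 1) := by
      exact_mod_cast (le_firstPassage (X := X) (u := u) (ω := ω)).trans hle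
    exact ⟨n, hu, (stoppedChain_eq_inl_iff hrc hu a ω).2 ⟨hle, ha⟩⟩
  · rintro ⟨n, hu, h⟩
    obtain ⟨h1, h2⟩ := (stoppedChain_eq_inl_iff hrc hu a ω).1 h
    refine ⟨h1.trans_lt ?_, h2⟩
    exact_mod_cast sub_lt_self t (by positivity)

lemma measurableSet_startEvent : MeasurableSet[past X u u] (startEvent X u j q) :=
  measurableSet_past ⟨le_rfl, le_rfl⟩ {Sum.inr (j, q)}

variable [MeasurableSpace Ω] {P μ : Measure Ω}

/-- The row vector of the probabilities that the stopped chain is on level `n` at time `r`, resolved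
by the phases; it is extended to times `r < u` as a constant. -/
noncomputable def levelVector (μ : Measure Ω) (X : ℝ → Ω → State k m) (u : ℝ) (n : ℕ) (r : ℝ)
    (p : Phase k m) : ℝ :=
  ∫ ω, levelIndicator n p (stoppedChain X u (max u r) ω) ∂μ

/-- The row vector of level `n` without the absorbing level `0`. -/
noncomputable def aliveVector (μ : Measure Ω) (X : ℝ → Ω → State k m) (u : ℝ) (n : ℕ) (r : ℝ)
    (p : Phase k m) : ℝ :=
  if n = 0 then 0 else levelVector μ X u n r p

/-- The right-hand side of the forward equation on level `n`. -/
noncomputable def levelRate (lam mu : ℝ → ℝ) (μ : Measure Ω) (X : ℝ → Ω → State k m) (u : ℝ)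
    (n : ℕ) (r : ℝ) (i : Phase k m) : ℝ :=
  Matrix.vecMul (aliveVector μ X u (n - 1) r) (Apos lam r) i +
    Matrix.vecMul (aliveVector μ X u n r) (Azero lam mu r) i +
    Matrix.vecMul (levelVector μ X u (n + 1) r) (Aneg mu r) i

lemma abs_levelVector_le [IsProbabilityMeasure μ] (n : ℕ) (r : ℝ) (p : Phase k m) :
    |levelVector μ X u n r p| ≤ 1 := by
  have h := norm_integral_le_of_norm_le_const (μ := μ) (C := 1)
    (f := fun ω => levelIndicator n p (stoppedChain X u (max u r) ω))
    (ae_of_all _ fun ω => abs_levelIndicator_le n p _)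
  simpa [levelVector] using h

lemma integrable_levelIndicator [IsProbabilityMeasure μ]
    (hX : IsMarkovChain P (generator lam mu) u X) (n : ℕ) (p : Phase k m) (r : ℝ) :
    Integrable (fun ω => levelIndicator n p (stoppedChain X u (max u r) ω)) μ :=
  (integrable_const (1 : ℝ)).mono'
    ((measurable_comp_stoppedChain hX (levelIndicator n p)).comp
      measurable_prodMk_left).aestronglyMeasurable
    (ae_of_all _ fun _ => abs_levelIndicator_le n p _)

lemma integral_levelGenerator [IsProbabilityMeasure μ]
    (hX : IsMarkovChain P (generator lam mu) u X) (n : ℕ) (i : Phase k m) (r : ℝ) :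
    ∫ ω, levelGenerator lam mu n i r (stoppedChain X u (max u r) ω) ∂μ =
      levelRate lam mu μ X u n r i := by
  have h (l : ℕ) (p : Phase k m) := integrable_levelIndicator (μ := μ) hX l p r
  have h' (l : ℕ) (p : Phase k m) : Integrable (fun ω =>
      if l = 0 then 0 else levelIndicator l p (stoppedChain X u (max u r) ω)) μ := by
    by_cases hl : l = 0
    · simp [hl]
    · simpa [hl] using h l p
  have e (l : ℕ) (p : Phase k m) : ∫ ω, (if l = 0 then 0 else
      levelIndicator l p (stoppedChain X u (max u r) ω)) ∂μ = aliveVector μ X u l r p := by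
    by_cases hl : l = 0
    · simp [hl, aliveVector]
    · simp [hl, aliveVector, levelVector]
  have hA (p : Phase k m) := (h' (n - 1) p).mul_const (Apos lam r p i)
  have hB (p : Phase k m) := (h' n p).mul_const (Azero lam mu r p i)
  have hC (p : Phase k m) := (h (n + 1) p).mul_const (Aneg mu r p i)
  have hAB (p : Phase k m) := (hA p).fun_add (hB p)
  simp only [levelGenerator]
  rw [integral_finsetSum _ fun p _ => (hAB p).fun_add (hC p)]
  simp only [levelRate, Matrix.vecMul, dotProduct, ← Finset.sum_add_distrib]
  refine Finset.sum_congr rfl fun p _ => ?_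
  rw [integral_add (hAB p) (hC p), integral_add (hA p) (hB p), integral_mul_const,
    integral_mul_const, integral_mul_const, e, e]
  rfl

lemma integral_indicator_state [IsProbabilityMeasure μ]
    (hX : IsMarkovChain P (generator lam mu) u X) {t : ℝ} (hut : u ≤ t) (y : State k m) :
    ∫ ω, ({x | x = y}.indicator 1 (stoppedChain X u t ω) : ℝ) ∂μ =
      μ.real {ω | stoppedChain X u t ω = y} := by
  rw [← integral_indicator_one (measurableSet_stoppedChain hX hut y)]
  rfl

lemma cond_start_real [IsProbabilityMeasure P] (hX : IsMarkovChain P (generator lam mu) u X)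
    (hstart : P (startEvent X u j q) ≠ 0) (y : State k m) :
    (ProbabilityTheory.cond P (startEvent X u j q)).real {ω | X u ω = y} =
      if y = Sum.inr (j, q) then 1 else 0 := by
  have hm : MeasurableSet (startEvent X u j q) := hX.measurable u le_rfl _
  split_ifs with h
  · subst h
    change (ProbabilityTheory.cond P (startEvent X u j q)).real (startEvent X u j q) = 1
    rw [measureReal_def, ProbabilityTheory.cond_apply_self hstart (measure_ne_top _ _),
      ENNReal.toReal_one]
  · rw [measureReal_def, ProbabilityTheory.cond_apply hm]
    have : startEvent X u j q ∩ {ω | X u ω = y} = ∅ := by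
      ext ω
      simp only [startEvent, Set.mem_inter_iff, Set.mem_ofPred_eq, Set.mem_empty_iff_false,
        iff_false, not_and]
      rintro h1 rfl
      exact h h1
    simp [this]

/-- The forward equation of the stopped chain on level `n`, in integrated form. -/
theorem levelVector_eq [IsProbabilityMeasure P] (hX : IsMarkovChain P (generator lam mu) u X)
    (hlam : Continuous lam) (hmu : Continuous mu) (hstart : P (startEvent X u j q) ≠ 0) {t : ℝ}
    (hut : u ≤ t) (n : ℕ) (i : Phase k m) :
    levelVector (ProbabilityTheory.cond P (startEvent X u j q)) X u n t i =
      (if n = j ∧ i = q then 1 else 0) + ∫ r in u..t,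
        levelRate lam mu (ProbabilityTheory.cond P (startEvent X u j q)) X u n r i := by
  have hprob := ProbabilityTheory.cond_isProbabilityMeasure hstart
  have key (y : State k m) := stopped_forward_equation hX hlam hmu hut y
    (measurableSet_startEvent (X := X) (u := u) (j := j) (q := q))
  simp only [cond_start_real hX hstart] at key
  set μ := ProbabilityTheory.cond P (startEvent X u j q)
  simp only [← integral_levelGenerator (μ := μ) hX, levelVector, max_eq_right hut]
  rcases Nat.eq_zero_or_pos n with rfl | hn
  · have hj : ¬ (0 = (j : ℕ) ∧ i = q) := fun h => j.pos.ne h.1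
    rw [if_neg hj]
    by_cases hi : i.2.val = 0
    · simp only [levelIndicator_zero i hi, ← stoppedGenerator_eq_levelGenerator_zero _ _ _ _ i hi,
        integral_indicator_state hX hut, key]
      simp
    · simp [levelIndicator_zero_of_ne i hi, levelGenerator_zero_of_ne _ _ _ _ i hi]
  · lift n to ℕ+ using hn
    simp only [levelIndicator_pos, ← stoppedGenerator_eq_levelGenerator,
      integral_indicator_state hX hut, key]
    simp [Prod.ext_iff]

lemma continuous_levelVector [IsProbabilityMeasure P]
    (hX : IsMarkovChain P (generator lam mu) u X)
    (hlam : Continuous lam) (hmu : Continuous mu) (hstart : P (startEvent X u j q) ≠ 0) (n : ℕ)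
    (i : Phase k m) :
    Continuous fun t =>
      levelVector (ProbabilityTheory.cond P (startEvent X u j q)) X u n t i := by
  have hprob := ProbabilityTheory.cond_isProbabilityMeasure hstart
  set μ := ProbabilityTheory.cond P (startEvent X u j q) with hμ
  have hmeas (n : ℕ) (p : Phase k m) : Measurable fun r => levelVector μ X u n r p :=
    (measurable_comp_stoppedChain hX (levelIndicator n p)).stronglyMeasurable.integral_prod_right'
      |>.measurable
  have hmeas' (n : ℕ) (p : Phase k m) : Measurable fun r => aliveVector μ X u n r p := by
    by_cases hn : n = 0
    · simp [aliveVector, hn]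
    · simpa [aliveVector, hn] using hmeas n p
  have hbound' (n : ℕ) (r : ℝ) (p : Phase k m) : |aliveVector μ X u n r p| ≤ 1 := by
    by_cases hn : n = 0
    · simp [aliveVector, hn]
    · simpa [aliveVector, hn] using abs_levelVector_le n r p
  have hint (v : ℝ → Phase k m → ℝ) (hv : ∀ p, Measurable fun r => v r p)
      (hb : ∀ r p, |v r p| ≤ 1) (A : ℝ → Matrix (Phase k m) (Phase k m) ℝ)
      (hA : ∀ p, Continuous fun r => A r p i) (a b : ℝ) :
      IntervalIntegrable (fun r => Matrix.vecMul (v r) (A r) i) volume a b := by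
    simp only [Matrix.vecMul, dotProduct]
    have hp (p : Phase k m) : IntervalIntegrable (fun r => v r p * A r p i) volume a b := by
      refine ((hA p).norm.intervalIntegrable a b).mono_fun
        ((hv p).mul (hA p).measurable).aestronglyMeasurable (ae_of_all _ fun r => ?_)
      simp only [norm_mul, norm_norm]
      exact mul_le_of_le_one_left (norm_nonneg _) (hb r p)
    convert! IntervalIntegrable.sum Finset.univ fun p _ => hp p using 1
    ext r
    simp
  have hrate (a b : ℝ) : IntervalIntegrable (fun r => levelRate lam mu μ X u n r i) volume a b :=
    ((hint _ (hmeas' (n - 1)) (hbound' (n - 1)) _ (fun p => continuous_Apos_apply hlam p i) a b).add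
      (hint _ (hmeas' n) (hbound' n) _ (fun p => continuous_Azero_apply hlam hmu p i) a b)).add
      (hint _ (hmeas (n + 1)) (fun r p => abs_levelVector_le (n + 1) r p) _
        (fun p => continuous_Aneg_apply hmu p i) a b)
  have heq : (fun t => levelVector μ X u n t i) = fun t => (if n = j ∧ i = q then 1 else 0) +
      ∫ r in u..max u t, levelRate lam mu μ X u n r i := by
    funext t
    rw [hμ, ← levelVector_eq hX hlam hmu hstart (le_max_left u t)]
    simp [levelVector]
  rw [heq]
  exact (continuous_const (y := (if n = j ∧ i = q then (1 : ℝ) else 0))).add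
    ((intervalIntegral.continuous_primitive hrate u).comp (continuous_const.max continuous_id))

lemma continuous_aliveVector [IsProbabilityMeasure P]
    (hX : IsMarkovChain P (generator lam mu) u X)
    (hlam : Continuous lam) (hmu : Continuous mu) (hstart : P (startEvent X u j q) ≠ 0) (n : ℕ)
    (i : Phase k m) :
    Continuous fun t =>
      aliveVector (ProbabilityTheory.cond P (startEvent X u j q)) X u n t i := by
  by_cases hn : n = 0
  · simpa [aliveVector, hn] using continuous_const
  · simpa [aliveVector, hn] using continuous_levelVector hX hlam hmu hstart n i

theorem hasDerivAt_levelVector [IsProbabilityMeasure P]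
    (hX : IsMarkovChain P (generator lam mu) u X)
    (hlam : Continuous lam) (hmu : Continuous mu) (hstart : P (startEvent X u j q) ≠ 0) (n : ℕ)
    (i : Phase k m) {t : ℝ} (hut : u < t) :
    HasDerivAt (fun t => levelVector (ProbabilityTheory.cond P (startEvent X u j q)) X u n t i)
      (levelRate lam mu (ProbabilityTheory.cond P (startEvent X u j q)) X u n t i) t := by
  have hc : Continuous fun r =>
      levelRate lam mu (ProbabilityTheory.cond P (startEvent X u j q)) X u n r i := by
    simp only [levelRate, Matrix.vecMul, dotProduct]
    refine Continuous.add (Continuous.add (continuous_finsetSum _ fun p _ => ?_)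
      (continuous_finsetSum _ fun p _ => ?_)) (continuous_finsetSum _ fun p _ => ?_)
    · exact (continuous_aliveVector hX hlam hmu hstart _ p).mul (continuous_Apos_apply hlam p i)
    · exact (continuous_aliveVector hX hlam hmu hstart _ p).mul
        (continuous_Azero_apply hlam hmu p i)
    · exact (continuous_levelVector hX hlam hmu hstart _ p).mul (continuous_Aneg_apply hmu p i)
  refine ((hc.integral_hasStrictDerivAt u t).hasDerivAt.const_add
    (if n = j ∧ i = q then (1 : ℝ) else 0)).congr_of_eventuallyEq ?_
  filter_upwards [Ioi_mem_nhds hut] with s hs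
  exact levelVector_eq hX hlam hmu hstart (le_of_lt hs) n i

/-! ### The first-passage vector -/

lemma measurableSet_passage (hX : IsMarkovChain P (generator lam mu) u X) (t : ℝ) (a : Fin k) :
    MeasurableSet {ω | firstPassage X u ω < (t : EReal) ∧
      X (firstPassage X u ω).toReal ω = Sum.inl a} := by
  rw [passage_eq_iUnion hX.right_continuous]
  exact MeasurableSet.iUnion fun n => MeasurableSet.iUnion fun h =>
    measurableSet_stoppedChain hX h _

/-- The entries of the first-passage vector add up to the first-passage distribution. -/
theorem sum_passageVector (hX : IsMarkovChain P (generator lam mu) u X) (t : ℝ) :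
    ∑ i, passageVector P X u j q t i =
      (ProbabilityTheory.cond P (startEvent X u j q)).real
        {ω | firstPassage X u ω < (t : EReal)} := by
  have hm : 0 < m := (Nat.zero_le _).trans_lt q.2.2
  have hunion : {ω | firstPassage X u ω < (t : EReal)} = ⋃ a : Fin k,
      {ω | firstPassage X u ω < (t : EReal) ∧ X (firstPassage X u ω).toReal ω = Sum.inl a} := by
    ext ω
    simp only [Set.mem_ofPred_eq, Set.mem_iUnion, exists_and_left]
    exact ⟨fun h => ⟨h, exists_eq_inl_firstPassage (hX.right_continuous ω) h.le⟩, fun h => h.1⟩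
  rw [hunion, measureReal_iUnion_fintype ?_ fun a => measurableSet_passage hX t a,
    Fintype.sum_prod_type]
  · refine Finset.sum_congr rfl fun a _ => ?_
    rw [Finset.sum_eq_single (⟨0, hm⟩ : Fin m)]
    · simp [passageVector]
    · intro s _ hs
      have : s.val ≠ 0 := fun h => hs (Fin.ext h)
      simp [passageVector, this]
    · simp
  · intro a b hab
    refine Set.disjoint_left.2 fun ω h1 h2 => hab ?_
    exact Sum.inl_injective (h1.2.symm.trans h2.2)

/-- The first-passage vector is the level `0` vector of the stopped chain. The events differ by
the event that the first passage takes place at time `t` precisely; it has probability zero because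
the distribution of the stopped chain is continuous in time. -/
theorem passageVector_eq_levelVector [IsProbabilityMeasure P]
    (hX : IsMarkovChain P (generator lam mu) u X)
    (hlam : Continuous lam) (hmu : Continuous mu) (hstart : P (startEvent X u j q) ≠ 0) {t : ℝ}
    (hut : u ≤ t) (i : Phase k m) :
    passageVector P X u j q t i =
      levelVector (ProbabilityTheory.cond P (startEvent X u j q)) X u 0 t i := by
  have hprob := ProbabilityTheory.cond_isProbabilityMeasure hstart
  have hcont := continuous_levelVector hX hlam hmu hstart 0 i
  have hinit := levelVector_eq hX hlam hmu hstart le_rfl 0 i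
  simp only [passageVector]
  set μ := ProbabilityTheory.cond P (startEvent X u j q)
  split_ifs with hi
  · have hlev (s : ℝ) (hs : u ≤ s) :
        levelVector μ X u 0 s i = μ.real {ω | stoppedChain X u s ω = Sum.inl i.1} := by
      simp only [levelVector, max_eq_right hs, levelIndicator_zero i hi,
        integral_indicator_state hX hs]
    refine le_antisymm ?_ ?_
    · rw [hlev t hut]
      refine measureReal_mono fun ω hω => ?_
      exact (stoppedChain_eq_inl_iff hX.right_continuous hut i.1 ω).2 ⟨hω.1.le, hω.2⟩
    · rcases hut.eq_or_lt with rfl | hut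
      · have hj : ¬ (0 = (j : ℕ) ∧ i = q) := fun h => j.pos.ne h.1
        rw [hinit, if_neg hj]
        simp
      · have hlim : Tendsto (fun n : ℕ => t - 1 / ((n : ℝ) + 1)) atTop (𝓝 t) := by
          simpa using (tendsto_one_div_add_atTop_nhds_zero_nat (𝕜 := ℝ)).const_sub t
        refine le_of_tendsto ((hcont.tendsto t).comp hlim) ?_
        filter_upwards [hlim.eventually (lt_mem_nhds hut)] with n hn
        simp only [Function.comp_apply]
        rw [hlev _ hn.le]
        refine measureReal_mono ?_
        rw [passage_eq_iUnion hX.right_continuous]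
        exact Set.subset_iUnion₂_of_subset n hn.le le_rfl
  · simp [levelVector, levelIndicator_zero_of_ne i hi]

end LevelVector

/-! ### The Volterra equation -/

section Volterra

variable {k m : ℕ} {lam mu : ℝ → ℝ} {Φ : ℂ → ℝ → ℝ → Matrix (Phase k m) (Phase k m) ℂ}
  {Ω : Type*} [MeasurableSpace Ω] {P μ : Measure Ω} {u : ℝ} {X : ℝ → Ω → State k m} {j : ℕ+}
  {q : Phase k m}

/-- The row vector of level `n` with complex entries. -/
noncomputable def levelVectorC (μ : Measure Ω) (X : ℝ → Ω → State k m) (u : ℝ) (n : ℕ) (r : ℝ)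
    (p : Phase k m) : ℂ := (levelVector μ X u n r p : ℂ)

/-- The row vector of level `n` without the absorbing level `0`, with complex entries. -/
noncomputable def aliveVectorC (μ : Measure Ω) (X : ℝ → Ω → State k m) (u : ℝ) (n : ℕ) (r : ℝ) :
    Phase k m → ℂ := if n = 0 then 0 else levelVectorC μ X u n r

/-- What remains of the telescoping sum of the derivatives of `v_n(ν) [z⁻ⁿ]Φ(z, ν, t)`, `n ≤ M`,
besides the Volterra kernel: the exchange between the levels `M` and `M + 1`. -/
noncomputable def boundaryTerm (lam mu : ℝ → ℝ)
    (Φ : ℂ → ℝ → ℝ → Matrix (Phase k m) (Phase k m) ℂ) (μ : Measure Ω) (X : ℝ → Ω → State k m)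
    (u : ℝ) (M : ℕ) (ν t : ℝ) : Phase k m → ℂ :=
  Matrix.vecMul (levelVectorC μ X u (M + 1) ν)
      ((Aneg mu ν).map Complex.ofReal * laurentCoeff (-(M : ℤ)) (fun z => Φ z ν t)) -
    Matrix.vecMul (aliveVectorC μ X u M ν)
      ((Apos lam ν).map Complex.ofReal * laurentCoeff (-(M : ℤ) - 1) (fun z => Φ z ν t))

lemma ofReal_levelRate (n : ℕ) (r : ℝ) :
    (fun i => (levelRate lam mu μ X u n r i : ℂ)) =
      Matrix.vecMul (aliveVectorC μ X u (n - 1) r) ((Apos lam r).map Complex.ofReal) +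
        Matrix.vecMul (aliveVectorC μ X u n r) ((Azero lam mu r).map Complex.ofReal) +
        Matrix.vecMul (levelVectorC μ X u (n + 1) r) ((Aneg mu r).map Complex.ofReal) := by
  have h (n : ℕ) : aliveVectorC μ X u n r = fun p => (aliveVector μ X u n r p : ℂ) := by
    funext p
    by_cases hn : n = 0 <;> simp [aliveVectorC, aliveVector, hn, levelVectorC]
  funext i
  simp only [h, levelRate, Matrix.vecMul, dotProduct, Pi.add_apply, Matrix.map_apply, levelVectorC]
  push_cast
  rfl

lemma hasDerivAt_vecMul {v : ℝ → Phase k m → ℂ} {F : ℝ → Matrix (Phase k m) (Phase k m) ℂ}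
    {v' : Phase k m → ℂ} {F' : Matrix (Phase k m) (Phase k m) ℂ} {ν : ℝ}
    (hv : ∀ p, HasDerivAt (fun s => v s p) (v' p) ν)
    (hF : ∀ p q, HasDerivAt (fun s => F s p q) (F' p q) ν) (i : Phase k m) :
    HasDerivAt (fun s => Matrix.vecMul (v s) (F s) i)
      ((Matrix.vecMul v' (F ν) + Matrix.vecMul (v ν) F') i) ν := by
  simp only [Matrix.vecMul, dotProduct, Pi.add_apply, ← Finset.sum_add_distrib]
  exact HasDerivAt.fun_sum fun p _ => (hv p).mul (hF p i)

lemma hasDerivAt_level_term [IsProbabilityMeasure P]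
    (hX : IsMarkovChain P (generator lam mu) u X) (hlam : Continuous lam) (hmu : Continuous mu)
    (hstart : P (startEvent X u j q) ≠ 0)
    (hΦ : ∀ z, z ≠ 0 → IsEvolutionOperator (Az lam mu z) (Φ z)) (n : ℕ) {ν : ℝ} (hν : u < ν)
    (t : ℝ) (i : Phase k m) :
    HasDerivAt (fun ν => Matrix.vecMul
        (levelVectorC (ProbabilityTheory.cond P (startEvent X u j q)) X u n ν)
        (laurentCoeff (-(n : ℤ)) (fun z => Φ z ν t)) i)
      ((Matrix.vecMul (fun i => (levelRate lam mu
          (ProbabilityTheory.cond P (startEvent X u j q)) X u n ν i : ℂ))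
          (laurentCoeff (-(n : ℤ)) (fun z => Φ z ν t)) +
        Matrix.vecMul (levelVectorC (ProbabilityTheory.cond P (startEvent X u j q)) X u n ν)
          (-convCoeff lam mu Φ (-(n : ℤ)) ν t)) i) ν :=
  hasDerivAt_vecMul (fun p => (hasDerivAt_levelVector hX hlam hmu hstart n p hν).ofReal_comp)
    (fun p q => hasDerivAt_laurentCoeff hlam hmu hΦ (-(n : ℤ)) ν t p q) i

/-- The forward equations of the levels and the backward equations of the Laurent coefficients
cancel, except for the Volterra kernel, which is due to the absorbing level `0`, and the
boundary term. -/
theorem hasDerivAt_level_sum [IsProbabilityMeasure P]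
    (hX : IsMarkovChain P (generator lam mu) u X) (hlam : Continuous lam) (hmu : Continuous mu)
    (hstart : P (startEvent X u j q) ≠ 0)
    (hΦ : ∀ z, z ≠ 0 → IsEvolutionOperator (Az lam mu z) (Φ z)) (M : ℕ) {ν : ℝ} (hν : u < ν)
    (t : ℝ) (i : Phase k m) :
    HasDerivAt (fun ν => ∑ n ∈ Finset.range (M + 1), Matrix.vecMul
        (levelVectorC (ProbabilityTheory.cond P (startEvent X u j q)) X u n ν)
        (laurentCoeff (-(n : ℤ)) (fun z => Φ z ν t)) i)
      (boundaryTerm lam mu Φ (ProbabilityTheory.cond P (startEvent X u j q)) X u M ν t i -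
        Matrix.vecMul (levelVectorC (ProbabilityTheory.cond P (startEvent X u j q)) X u 0 ν)
          (volterraKernel lam mu Φ ν t) i) ν := by
  have hterm (n : ℕ) := hasDerivAt_level_term hX hlam hmu hstart hΦ n hν t i
  set μ := ProbabilityTheory.cond P (startEvent X u j q)
  induction M with
  | zero =>
    simp only [zero_add, Finset.sum_range_one]
    convert! hterm 0 using 1
    rw [ofReal_levelRate, volterraKernel_eq]
    simp [boundaryTerm, aliveVectorC, Matrix.vecMul_vecMul, Matrix.vecMul_neg, sub_eq_add_neg]
  | succ M ih =>
    simp only [Finset.sum_range_succ _ (M + 1)]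
    convert! ih.add (hterm (M + 1)) using 1
    have e1 : -((M + 1 : ℕ) : ℤ) + 1 = -(M : ℤ) := by push_cast; ring
    have e2 : -(M : ℤ) - 1 = -((M + 1 : ℕ) : ℤ) := by push_cast; ring
    have halive : aliveVectorC μ X u (M + 1) ν = levelVectorC μ X u (M + 1) ν := by
      simp [aliveVectorC]
    rw [ofReal_levelRate]
    simp only [boundaryTerm, convCoeff, e1, e2, halive, Nat.add_sub_cancel, Matrix.vecMul_neg,
      Matrix.vecMul_add, Matrix.add_vecMul, Matrix.vecMul_vecMul, Pi.add_apply, Pi.sub_apply,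
      Pi.neg_apply]
    ring

lemma norm_levelVectorC_le [IsProbabilityMeasure μ] (n : ℕ) (r : ℝ) (p : Phase k m) :
    ‖levelVectorC μ X u n r p‖ ≤ 1 := by
  rw [levelVectorC, Complex.norm_real]
  exact abs_levelVector_le n r p

lemma norm_aliveVectorC_le [IsProbabilityMeasure μ] (n : ℕ) (r : ℝ) (p : Phase k m) :
    ‖aliveVectorC μ X u n r p‖ ≤ 1 := by
  by_cases hn : n = 0
  · simp [aliveVectorC, hn]
  · simpa [aliveVectorC, hn] using norm_levelVectorC_le n r p

lemma norm_vecMul_mul_le {v : Phase k m → ℂ} (hv : ∀ p, ‖v p‖ ≤ 1)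
    (A : Matrix (Phase k m) (Phase k m) ℝ) (F : Matrix (Phase k m) (Phase k m) ℂ)
    (i : Phase k m) :
    ‖Matrix.vecMul v (A.map Complex.ofReal * F) i‖ ≤ ∑ p, ∑ l, |A p l| * ‖F l i‖ := by
  simp only [Matrix.vecMul, dotProduct, Matrix.mul_apply]
  refine (norm_sum_le _ _).trans (Finset.sum_le_sum fun p _ => ?_)
  rw [norm_mul]
  refine (mul_le_of_le_one_left (norm_nonneg _) (hv p)).trans ?_
  refine (norm_sum_le _ _).trans_eq (Finset.sum_congr rfl fun l _ => ?_)
  rw [norm_mul, Matrix.map_apply, Complex.norm_real, Real.norm_eq_abs]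

/-- Probabilities are at most one, so two Laurent coefficients control the boundary term. -/
lemma norm_boundaryTerm_le [IsProbabilityMeasure μ] (M : ℕ) (ν t : ℝ) (i : Phase k m) :
    ‖boundaryTerm lam mu Φ μ X u M ν t i‖ ≤
      (∑ p, ∑ l, |Aneg mu ν p l| * ‖laurentCoeff (-(M : ℤ)) (fun z => Φ z ν t) l i‖) +
        ∑ p, ∑ l, |Apos lam ν p l| * ‖laurentCoeff (-(M : ℤ) - 1) (fun z => Φ z ν t) l i‖ :=
  (norm_sub_le _ _).trans (add_le_add
    (norm_vecMul_mul_le (norm_levelVectorC_le _ _) _ _ _)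
    (norm_vecMul_mul_le (norm_aliveVectorC_le _ _) _ _ _))

lemma continuous_vecMul {v : ℝ → Phase k m → ℂ} {F : ℝ → Matrix (Phase k m) (Phase k m) ℂ}
    (hv : ∀ p, Continuous fun s => v s p) (hF : ∀ p q, Continuous fun s => F s p q)
    (i : Phase k m) : Continuous fun s => Matrix.vecMul (v s) (F s) i := by
  simp only [Matrix.vecMul, dotProduct]
  exact continuous_finsetSum _ fun p _ => (hv p).mul (hF p i)

lemma continuous_ofReal_mul {A : ℝ → Matrix (Phase k m) (Phase k m) ℝ}
    {F : ℝ → Matrix (Phase k m) (Phase k m) ℂ} (hA : ∀ p q, Continuous fun s => A s p q)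
    (hF : ∀ p q, Continuous fun s => F s p q) (p q : Phase k m) :
    Continuous fun s => ((A s).map Complex.ofReal * F s) p q := by
  simp only [Matrix.mul_apply, Matrix.map_apply]
  exact continuous_finsetSum _ fun l _ => (Complex.continuous_ofReal.comp (hA p l)).mul (hF l q)

lemma continuous_volterraKernel (hlam : Continuous lam) (hmu : Continuous mu)
    (hΦ : ∀ z, z ≠ 0 → IsEvolutionOperator (Az lam mu z) (Φ z)) (t : ℝ) (p q : Phase k m) :
    Continuous fun ν => volterraKernel lam mu Φ ν t p q := by
  have hF (n : ℤ) := continuous_laurentCoeff hlam hmu hΦ n t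
  exact ((continuous_ofReal_mul (continuous_Aneg_apply hmu) (hF 1) p q).add
    (continuous_ofReal_mul (continuous_Azero_apply hlam hmu) (hF 0) p q)).add
    (continuous_ofReal_mul (continuous_Apos_apply hlam) (hF (-1)) p q)

section

variable [IsProbabilityMeasure P] (hX : IsMarkovChain P (generator lam mu) u X)
  (hlam : Continuous lam) (hmu : Continuous mu) (hstart : P (startEvent X u j q) ≠ 0)
  (hΦ : ∀ z, z ≠ 0 → IsEvolutionOperator (Az lam mu z) (Φ z))
include hX hlam hmu hstart

lemma continuous_levelVectorC (n : ℕ) (p : Phase k m) : Continuous fun ν =>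
    levelVectorC (ProbabilityTheory.cond P (startEvent X u j q)) X u n ν p :=
  Complex.continuous_ofReal.comp (continuous_levelVector hX hlam hmu hstart n p)

lemma continuous_aliveVectorC (n : ℕ) (p : Phase k m) : Continuous fun ν =>
    aliveVectorC (ProbabilityTheory.cond P (startEvent X u j q)) X u n ν p := by
  by_cases hn : n = 0
  · simpa [aliveVectorC, hn] using continuous_const
  · simpa [aliveVectorC, hn] using continuous_levelVectorC hX hlam hmu hstart n p

include hΦ

lemma continuous_boundaryTerm (M : ℕ) (t : ℝ) (i : Phase k m) : Continuous fun ν =>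
    boundaryTerm lam mu Φ (ProbabilityTheory.cond P (startEvent X u j q)) X u M ν t i := by
  have hF (n : ℤ) := continuous_laurentCoeff hlam hmu hΦ n t
  exact (continuous_vecMul (continuous_levelVectorC hX hlam hmu hstart _)
    (continuous_ofReal_mul (continuous_Aneg_apply hmu) (hF _)) i).sub
    (continuous_vecMul (continuous_aliveVectorC hX hlam hmu hstart _)
      (continuous_ofReal_mul (continuous_Apos_apply hlam) (hF _)) i)

lemma continuous_volterraIntegrand (t : ℝ) (i : Phase k m) : Continuous fun ν =>
    Matrix.vecMul (levelVectorC (ProbabilityTheory.cond P (startEvent X u j q)) X u 0 ν)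
      (volterraKernel lam mu Φ ν t) i :=
  continuous_vecMul (continuous_levelVectorC hX hlam hmu hstart 0)
    (continuous_volterraKernel hlam hmu hΦ t) i

/-- The Volterra equation up to the integrated boundary term. At the end point `ν = t` of the
integration only level `0` contributes, since `Φ(z, t, t) = I`; at `ν = u` only level `j` does. -/
lemma volterra_truncated {t : ℝ} (hut : u ≤ t) (i : Phase k m) {M : ℕ} (hM : (j : ℕ) ≤ M) :
    levelVectorC (ProbabilityTheory.cond P (startEvent X u j q)) X u 0 t i =
      Matrix.vecMul (Pi.single q (1 : ℂ)) (laurentCoeff (-(j : ℤ)) (fun z => Φ z u t)) i -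
        (∫ ν in u..t, Matrix.vecMul
          (levelVectorC (ProbabilityTheory.cond P (startEvent X u j q)) X u 0 ν)
          (volterraKernel lam mu Φ ν t) i) +
        ∫ ν in u..t,
          boundaryTerm lam mu Φ (ProbabilityTheory.cond P (startEvent X u j q)) X u M ν t i := by
  have hb := continuous_boundaryTerm hX hlam hmu hstart hΦ M t i
  have hv := continuous_volterraIntegrand hX hlam hmu hstart hΦ t i
  have hinit (n : ℕ) : levelVectorC (ProbabilityTheory.cond P (startEvent X u j q)) X u n u =
      if n = j then Pi.single q (1 : ℂ) else 0 := by
    funext p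
    rw [levelVectorC, levelVector_eq hX hlam hmu hstart le_rfl, intervalIntegral.integral_same,
      add_zero]
    by_cases hn : n = j <;> by_cases hp : p = q <;> simp [hn, hp]
  have hc (n : ℕ) : Continuous fun ν => Matrix.vecMul
      (levelVectorC (ProbabilityTheory.cond P (startEvent X u j q)) X u n ν)
      (laurentCoeff (-(n : ℤ)) (fun z => Φ z ν t)) i :=
    continuous_vecMul (continuous_levelVectorC hX hlam hmu hstart n)
      (continuous_laurentCoeff hlam hmu hΦ _ t) i
  have hftc := intervalIntegral.integral_eq_sub_of_hasDerivAt_of_le hut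
    (continuous_finsetSum _ fun n _ => hc n).continuousOn
    (fun ν hν => hasDerivAt_level_sum hX hlam hmu hstart hΦ M hν.1 t i)
    ((hb.sub hv).intervalIntegrable u t)
  rw [intervalIntegral.integral_sub (hb.intervalIntegrable u t) (hv.intervalIntegrable u t)] at hftc
  have h1 : ∑ n ∈ Finset.range (M + 1), Matrix.vecMul
      (levelVectorC (ProbabilityTheory.cond P (startEvent X u j q)) X u n t)
      (laurentCoeff (-(n : ℤ)) (fun z => Φ z t t)) i =
      levelVectorC (ProbabilityTheory.cond P (startEvent X u j q)) X u 0 t i := by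
    rw [Finset.sum_eq_single 0]
    · simp [laurentCoeff_diag hΦ]
    · intro n _ hn
      simp [laurentCoeff_diag hΦ, hn]
    · simp
  have h2 : ∑ n ∈ Finset.range (M + 1), Matrix.vecMul
      (levelVectorC (ProbabilityTheory.cond P (startEvent X u j q)) X u n u)
      (laurentCoeff (-(n : ℤ)) (fun z => Φ z u t)) i =
      Matrix.vecMul (Pi.single q (1 : ℂ)) (laurentCoeff (-(j : ℤ)) (fun z => Φ z u t)) i := by
    rw [Finset.sum_eq_single (j : ℕ)]
    · rw [hinit, if_pos rfl]
    · intro n _ hn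
      rw [hinit, if_neg hn]
      simp
    · intro hj
      exact absurd (Finset.mem_range.2 (Nat.lt_succ_of_le hM)) hj
  rw [h1, h2] at hftc
  linear_combination -hftc

/-- The boundary terms vanish in the limit, since the Laurent coefficients do. -/
lemma tendsto_integral_boundaryTerm {t : ℝ} (hut : u ≤ t) (i : Phase k m) :
    Tendsto (fun M : ℕ => ∫ ν in u..t,
      boundaryTerm lam mu Φ (ProbabilityTheory.cond P (startEvent X u j q)) X u M ν t i)
      atTop (𝓝 0) := by
  have hprob := ProbabilityTheory.cond_isProbabilityMeasure hstart
  choose C hC using fun l => exists_norm_laurentCoeff_le hlam hmu hΦ u t l i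
  set bound : ℝ → ℝ := fun ν =>
    (∑ p, ∑ l, |Aneg mu ν p l| * C l) + ∑ p, ∑ l, |Apos lam ν p l| * C l with hbound
  have hcb : Continuous bound := by
    refine Continuous.add ?_ ?_ <;>
      refine continuous_finsetSum _ fun p _ => continuous_finsetSum _ fun l _ => ?_
    · exact (continuous_Aneg_apply hmu p l).abs.mul continuous_const
    · exact (continuous_Apos_apply hlam p l).abs.mul continuous_const
  rw [show (0 : ℂ) = ∫ ν in u..t, (0 : ℂ) by simp]
  refine intervalIntegral.tendsto_integral_filter_of_dominated_convergence bound
    (Eventually.of_forall fun M =>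
      (continuous_boundaryTerm hX hlam hmu hstart hΦ M t i).aestronglyMeasurable)
    (Eventually.of_forall fun M => ae_of_all _ fun ν hν => ?_) (hcb.intervalIntegrable u t)
    (ae_of_all _ fun ν _ => ?_)
  · rw [Set.uIoc_of_le hut] at hν
    refine (norm_boundaryTerm_le M ν t i).trans ?_
    simp only [hbound]
    gcongr with p _ l _ p _ l _ <;> exact hC l _ ν (Set.Ioc_subset_Icc_self hν)
  · have h1 : Tendsto (fun M : ℕ => -(M : ℤ)) atTop cofinite := by
      rw [← Nat.cofinite_eq_atTop]
      exact Function.Injective.tendsto_cofinite fun a b h => by simpa using h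
    have h2 : Tendsto (fun M : ℕ => -(M : ℤ) - 1) atTop cofinite := by
      rw [← Nat.cofinite_eq_atTop]
      exact Function.Injective.tendsto_cofinite fun a b h => by simpa using h
    have hF (l : Phase k m) := (tendsto_laurentCoeff hlam hmu hΦ ν t l i).norm
    refine squeeze_zero_norm (fun M => norm_boundaryTerm_le M ν t i) ?_
    rw [show (0 : ℝ) = (∑ p, ∑ l, |Aneg mu ν p l| * ‖(0 : ℂ)‖) +
      ∑ p : Phase k m, ∑ l : Phase k m, |Apos lam ν p l| * ‖(0 : ℂ)‖ by simp]
    exact (tendsto_finsetSum _ fun p _ => tendsto_finsetSum _ fun l _ =>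
      ((hF l).comp h1).const_mul _).add (tendsto_finsetSum _ fun p _ =>
        tendsto_finsetSum _ fun l _ => ((hF l).comp h2).const_mul _)

theorem volterra_equation {t : ℝ} (hut : u ≤ t) (i : Phase k m) :
    levelVectorC (ProbabilityTheory.cond P (startEvent X u j q)) X u 0 t i =
      Matrix.vecMul (Pi.single q (1 : ℂ)) (laurentCoeff (-(j : ℤ)) (fun z => Φ z u t)) i -
        ∫ ν in u..t, Matrix.vecMul
          (levelVectorC (ProbabilityTheory.cond P (startEvent X u j q)) X u 0 ν)
          (volterraKernel lam mu Φ ν t) i := by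
  have hlim := (tendsto_integral_boundaryTerm hX hlam hmu hstart hΦ hut i).const_add
    (Matrix.vecMul (Pi.single q (1 : ℂ)) (laurentCoeff (-(j : ℤ)) (fun z => Φ z u t)) i -
      ∫ ν in u..t, Matrix.vecMul
        (levelVectorC (ProbabilityTheory.cond P (startEvent X u j q)) X u 0 ν)
        (volterraKernel lam mu Φ ν t) i)
  rw [add_zero] at hlim
  refine tendsto_nhds_unique (tendsto_const_nhds.congr' ?_) hlim
  filter_upwards [eventually_ge_atTop (j : ℕ)] with M hM
  exact volterra_truncated hX hlam hmu hstart hΦ hut i hM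

end

end Volterra

end ErlangQueue

theorem mainTheorem5 {k m : ℕ} (lam mu : ℝ → ℝ)
    (hlam : Continuous lam) (hmu : Continuous mu)
    (hlam0 : ∀ t, 0 ≤ lam t) (hmu0 : ∀ t, 0 ≤ mu t)
    {Ω : Type*} [MeasurableSpace Ω] (P : Measure Ω) [IsProbabilityMeasure P]
    (u : ℝ) (X : ℝ → Ω → ErlangQueue.State k m)
    (hX : ErlangQueue.IsMarkovChain P (ErlangQueue.generator lam mu) u X)
    (j : ℕ+) (q : ErlangQueue.Phase k m)
    (hstart : P (ErlangQueue.startEvent X u j q) ≠ 0) :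
    -- the entries of the first-passage vector add up to the first-passage distribution
    (∀ t, u ≤ t → ∑ i, ErlangQueue.passageVector P X u j q t i =
      (ProbabilityTheory.cond P (ErlangQueue.startEvent X u j q)).real
        {ω | ErlangQueue.firstPassage X u ω < (t : EReal)}) ∧
    -- the evolution operator exists for every `z ≠ 0`
    (∃ Φ : ℂ → ℝ → ℝ → Matrix (ErlangQueue.Phase k m) (ErlangQueue.Phase k m) ℂ,
      ∀ z, z ≠ 0 → ErlangQueue.IsEvolutionOperator (ErlangQueue.Az lam mu z) (Φ z)) ∧
    ∀ Φ : ℂ → ℝ → ℝ → Matrix (ErlangQueue.Phase k m) (ErlangQueue.Phase k m) ℂ,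
      (∀ z, z ≠ 0 → ErlangQueue.IsEvolutionOperator (ErlangQueue.Az lam mu z) (Φ z)) →
      -- it is the sum of its Laurent series
      (∀ ν t z, z ≠ 0 →
        HasSum (fun n : ℤ => z ^ n • ErlangQueue.laurentCoeff n (fun w => Φ w ν t)) (Φ z ν t)) ∧
      -- the Volterra equation of the second kind
      ∀ t, u ≤ t → ∀ i : ErlangQueue.Phase k m,
        IntervalIntegrable
          (fun ν => Matrix.vecMul
            (fun p => (ErlangQueue.passageVector P X u j q ν p : ℂ))
            (ErlangQueue.volterraKernel lam mu Φ ν t) i) volume u t ∧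
        (ErlangQueue.passageVector P X u j q t i : ℂ) =
          Matrix.vecMul (Pi.single q (1 : ℂ))
              (ErlangQueue.laurentCoeff (-(j : ℤ)) (fun z => Φ z u t)) i -
            ∫ ν in u..t, Matrix.vecMul
              (fun p => (ErlangQueue.passageVector P X u j q ν p : ℂ))
              (ErlangQueue.volterraKernel lam mu Φ ν t) i := by
  refine ⟨fun t _ => ErlangQueue.sum_passageVector hX t,
    ErlangQueue.exists_evolution hlam hmu, fun Φ hΦ =>
    ⟨fun ν t z hz => ErlangQueue.hasSum_laurentCoeff hlam hmu hΦ ν t hz, fun t hut i => ?_⟩⟩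
  have hpass (ν : ℝ) (hν : u ≤ ν) :
      (fun p => (ErlangQueue.passageVector P X u j q ν p : ℂ)) = ErlangQueue.levelVectorC
        (ProbabilityTheory.cond P (ErlangQueue.startEvent X u j q)) X u 0 ν := by
    funext p
    rw [ErlangQueue.passageVector_eq_levelVector hX hlam hmu hstart hν]
    rfl
  have heq : Set.EqOn (fun ν => Matrix.vecMul
      (fun p => (ErlangQueue.passageVector P X u j q ν p : ℂ))
      (ErlangQueue.volterraKernel lam mu Φ ν t) i)
      (fun ν => Matrix.vecMul (ErlangQueue.levelVectorC
        (ProbabilityTheory.cond P (ErlangQueue.startEvent X u j q)) X u 0 ν)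
        (ErlangQueue.volterraKernel lam mu Φ ν t) i) (Set.uIcc u t) := by
    intro ν hν
    rw [Set.uIcc_of_le hut] at hν
    simp only [hpass ν hν.1]
  constructor
  · refine ((ErlangQueue.continuous_volterraIntegrand hX hlam hmu hstart hΦ t
      i).intervalIntegrable u t).congr ?_
    exact fun ν hν => (heq (Set.uIoc_subset_uIcc hν)).symm
  · rw [intervalIntegral.integral_congr heq]
    exact (congrFun (hpass t hut) i).trans
      (ErlangQueue.volterra_equation hX hlam hmu hstart hΦ hut i)
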